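/- Let $(R,\mathfrak m)$ be a Noetherian local ring and let $J\subsetneq I$ be ideals of $R$ such that $J$ is a reduction of $I$ (i.e. $JI^n=I^{n+1}$ for some $n\ge 0$) and $\lambda(I^r/J^r)<\infty$ for some integer $r\ge 1$, where $\lambda$ denotes length of $R$-modules. Then for all large $n$ the length $\lambda(I^n/J^n)$ is finite and equal to $P(n)$ for a (necessarily unique) polynomial $P=P(I/J)\in\mathbb Q[X]$. Let $G(J)=\bigoplus_{n\ge 0}J^n/J^{n+1}$ and $G(J)_+=\bigoplus_{n\ge 1}J^n/J^{n+1}$; let $\operatorname{grade} G(J)_+$ be the maximal length of a $G(J)$-regular sequence contained in $G(J)_+$; and let $l(J)=\dim\bigoplus_{n\ge 0}J^n/\mathfrak mJ^n$ be the analytic spread of $J$. (Both numbers are finite.) With the convention that the zero polynomial has degree $-1$, $$\operatorname{grade} G(J)_+-1\;\le\;\deg P(I/J)\;\le\; l(J)-1.$$ Moreover, if $J$ is a complete intersection ideal, i.e. $J$ is generated by an $R$-regular sequence (possibly empty, in which case $J=0$), then $\deg P(I/J)=l(J)-1$. -/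

import Mathlib

open Polynomial Filter

namespace ReesDegree

section

variable {R : Type*} [CommRing R]

/-- `J` is a reduction of `I`: `J ⊆ I` and `J Iⁿ = Iⁿ⁺¹` for some `n`. -/
def IsReduction (J I : Ideal R) : Prop :=
  J ≤ I ∧ ∃ n : ℕ, J * I ^ n = I ^ (n + 1)

/-- The length `λ(Iⁿ / Jⁿ)` of the `R`-module `Iⁿ / Jⁿ` (for `J ⊆ I`). -/
noncomputable def powQuotLength (I J : Ideal R) (n : ℕ) : ℕ∞ :=
  Module.length R (↥(I ^ n) ⧸ Submodule.submoduleOf (J ^ n) (I ^ n))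

/-- `P` is the polynomial `P(I/J)`: for all large `n`, the length `λ(Iⁿ / Jⁿ)` is finite and
equal to `P(n)`. -/
def IsReesPolynomial (I J : Ideal R) (P : ℚ[X]) : Prop :=
  ∀ᶠ n : ℕ in atTop, ∃ k : ℕ, powQuotLength I J n = (k : ℕ∞) ∧ P.eval (n : ℚ) = (k : ℚ)

/-- There is at most one polynomial `P(I/J)`. -/
theorem IsReesPolynomial.unique {I J : Ideal R} {P Q : ℚ[X]}
    (hP : IsReesPolynomial I J P) (hQ : IsReesPolynomial I J Q) : P = Q := by
  obtain ⟨N, hN⟩ := eventually_atTop.1 (hP.and hQ)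
  refine Polynomial.eq_of_infinite_eval_eq P Q ?_
  refine Set.Infinite.mono (s := (fun n : ℕ => (n : ℚ)) '' Set.Ici N) ?_
    ((Set.Ici_infinite N).image (Nat.cast_injective.injOn))
  rintro _ ⟨n, hn, rfl⟩
  obtain ⟨⟨k, hk, hPk⟩, ⟨m, hm, hQm⟩⟩ := hN n hn
  have hkm : k = m := by
    rw [hk] at hm
    exact_mod_cast hm
  change P.eval (n : ℚ) = Q.eval (n : ℚ)
  rw [hPk, hQm, hkm]

/-- The degree of a polynomial, with the convention that the zero polynomial has degree `-1`. -/
noncomputable def polyDegree (P : ℚ[X]) : ℤ :=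
  open Classical in if P = 0 then -1 else (P.natDegree : ℤ)

/-- The ideal `⨁ₙ K Jⁿ tⁿ` of the Rees algebra `⨁ₙ Jⁿ tⁿ` of `J`. -/
def reesIdeal (K J : Ideal R) : Ideal (reesAlgebra J) where
  carrier := {f | ∀ n : ℕ, (f : R[X]).coeff n ∈ K * J ^ n}
  zero_mem' n := by simp
  add_mem' {f g} hf hg n := by
    simpa using (K * J ^ n).add_mem (hf n) (hg n)
  smul_mem' c {f} hf n := by
    change ((c : R[X]) * (f : R[X])).coeff n ∈ K * J ^ n
    rw [coeff_mul]
    refine Ideal.sum_mem _ ?_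
    rintro ⟨i, j⟩ hij
    rw [← Finset.HasAntidiagonal.mem_antidiagonal.mp hij, pow_add, mul_left_comm]
    exact Ideal.mul_mem_mul (c.2 i) (hf j)

/-- The associated graded ring `G(J) = ⨁ₙ Jⁿ / Jⁿ⁺¹`, as the quotient of `⨁ₙ Jⁿ tⁿ` by
`⨁ₙ Jⁿ⁺¹ tⁿ` (here `Jⁿ⁺¹` is written `J * J ^ n`). -/
abbrev AssocGraded (J : Ideal R) : Type _ :=
  reesAlgebra J ⧸ reesIdeal J J

/-- The ideal `G(J)₊ = ⨁_{n ≥ 1} Jⁿ / Jⁿ⁺¹` of `G(J)`. -/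
noncomputable def assocGradedPlus (J : Ideal R) : Ideal (AssocGraded J) :=
  Ideal.map (Ideal.Quotient.mk (reesIdeal J J))
    (RingHom.ker ((Polynomial.constantCoeff (R := R)).comp (reesAlgebra J).val.toRingHom))

/-- The grade of an ideal `𝔞`: the supremum of the lengths of the `A`-regular sequences
contained in `𝔞`. -/
noncomputable def grade {A : Type*} [CommRing A] (𝔞 : Ideal A) : ℕ∞ :=
  sSup {n : ℕ∞ | ∃ rs : List A, (∀ x ∈ rs, x ∈ 𝔞) ∧ RingTheory.Sequence.IsRegular A rs ∧
    n = (rs.length : ℕ∞)}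

/-- The fiber cone `⨁ₙ Jⁿ / 𝔪 Jⁿ` of an ideal `J` of a local ring with maximal ideal `𝔪`. -/
abbrev FiberCone [IsLocalRing R] (J : Ideal R) : Type _ :=
  reesAlgebra J ⧸ reesIdeal (IsLocalRing.maximalIdeal R) J

/-- The analytic spread `l(J)`: the Krull dimension of the fiber cone of `J`. -/
noncomputable def analyticSpread [IsLocalRing R] (J : Ideal R) : WithBot ℕ∞ :=
  ringKrullDim (FiberCone J)

/-- `J` is a complete intersection ideal: it is generated by an `R`-regular sequence
(the empty sequence, generating the zero ideal, being allowed). -/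
def IsCompleteIntersectionIdeal (J : Ideal R) : Prop :=
  ∃ rs : List R, RingTheory.Sequence.IsRegular R rs ∧ Ideal.ofList rs = J

end

end ReesDegree

/-!
Write `h(n) = λ(Iⁿ / Jⁿ)`.

*The polynomial.* Since `J` is a reduction of `I`, the filtration of `I` by its powers is stable as
a `J`-filtration, so `⨁ Iⁿ / Jⁿ` is a quotient of finitely generated modules over the Rees algebra
of `J`. The Hilbert–Serre theorem, proved here for a pair of `J`-filtrations by induction on the
number of generators of `J` acting nontrivially (`exists_polynomial_relLength_of_subset`), gives
`P(I/J)` as soon as `h(n)` is finite for large `n`.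

*Finiteness and the upper bound.* If `λ(Iʳ / Jʳ)` is finite for one `r ≥ 1`, a power of `𝔪` carries
`Iʳ` into `Jʳ`, and the reduction property carries this over to a fixed power `𝔪ᴷ` and all large
exponents (`IsReduction.exists_pow_mul_le`). Hence `Iⁿ / Jⁿ` with `n = N + j` is a quotient of
`Jʲ Iᴺ / 𝔪ᴷ Jʲ Iᴺ`, whose length is at most a constant times `λ(Jʲ / 𝔪 Jʲ)`, the Hilbert function of
the fiber cone (`exists_powQuotLength_add_le`). By Noether normalization, the partial sums of the
latter are `O(nˢ)` for some `s ≤ l(J)` (`exists_sum_relLength_le`), and summing a polynomial raises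
its degree by one.

*The lower bound.* Let `x ∈ Jᵉ` satisfy `Jⁿ⁺ᵉ : x = Jⁿ` for all `n`. Then multiplication by `x`
embeds `Iⁿ / Jⁿ` in `Iⁿ⁺ᵉ / Jⁿ⁺ᵉ`, with a cokernel that maps onto the corresponding quotient over
`R / x`, so that passing from `R / x` to `R` raises the order of growth by one
(`exists_multichoose_succ_le`). Such an `x` exists when `G(J)₊` contains a regular element: by
homogeneous prime avoidance a regular sequence in `G(J)₊` can be replaced by one of the same length
that starts with a homogeneous form of positive degree, and then `G(J / x) = G(J) / x` has a regular
sequence shorter by one (`exists_multichoose_le_of_isWeaklyRegular`). When `J` is generated by a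
regular sequence, its first element is such an `x` with `e = 1`, because the last element of a
regular sequence is a nonzerodivisor modulo the powers of the ideal generated by the others
(`mem_ofList_pow_smul_of_smul_mem`), and regular sequences in a local ring can be permuted. As the
analytic spread is at most the number of generators (`analyticSpread_le`), the lower and the upper
bound then agree.
-/

namespace ReesDegree

/-! ### Lengths of quotients of submodules -/

section RelativeLength

variable {R M N : Type*} [CommRing R] [AddCommGroup M] [Module R M] [AddCommGroup N] [Module R N]

/-- The length of `A / (A ∩ B)` for submodules `A`, `B` of a module. It is used for `B ≤ A`. -/
noncomputable def relLength (A B : Submodule R M) : ℕ∞ :=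
  Module.length R (↥A ⧸ B.submoduleOf A)

theorem powQuotLength_eq_relLength {R : Type*} [CommRing R] (I J : Ideal R) (n : ℕ) :
    powQuotLength I J n = relLength (I ^ n) (J ^ n) := rfl

theorem relLength_le_of_ker_le {Q : Type*} [AddCommGroup Q] [Module R Q] {A B : Submodule R M}
    (g : A →ₗ[R] Q) (hg : ∀ a : A, g a = 0 → (a : M) ∈ B) :
    relLength A B ≤ Module.length R Q := by
  have h1 : relLength A B ≤ Module.length R (A ⧸ LinearMap.ker g) :=
    Module.length_le_of_surjective (Submodule.factor (fun a ha => hg a ha))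
      (Submodule.factor_surjective _)
  exact h1.trans (Module.length_le_of_injective _ (LinearMap.ker_eq_bot.1
    (Submodule.ker_liftQ_eq_bot _ g le_rfl le_rfl)))

theorem relLength_ge_of_surjective {Q : Type*} [AddCommGroup Q] [Module R Q] {A B : Submodule R M}
    (g : A →ₗ[R] Q) (hg : ∀ a : A, (a : M) ∈ B → g a = 0) (hs : Function.Surjective g) :
    Module.length R Q ≤ relLength A B := by
  have h : B.submoduleOf A ≤ LinearMap.ker g := fun a ha => hg a ha
  exact Module.length_le_of_surjective ((B.submoduleOf A).liftQ g h)
    (LinearMap.range_eq_top.1 ((Submodule.range_liftQ _ g h).trans (LinearMap.range_eq_top.2 hs)))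

/-- A map `A → A'` under which only elements of `B` go into `B'` embeds `A / B` in `A' / B'`. -/
theorem relLength_le_of_comap {A B : Submodule R M} {A' B' : Submodule R N} (f : M →ₗ[R] N)
    (hA : ∀ a ∈ A, f a ∈ A') (hB : ∀ a ∈ A, f a ∈ B' → a ∈ B) :
    relLength A B ≤ relLength A' B' := by
  refine relLength_le_of_ker_le ((B'.submoduleOf A').mkQ ∘ₗ f.restrict hA) ?_
  intro a ha
  rw [LinearMap.comp_apply, Submodule.mkQ_apply, Submodule.Quotient.mk_eq_zero] at ha
  exact hB a a.2 ha

/-- A map `A → A'` carrying `A ∩ B` into `B'` and onto `A'` modulo `B'` is a surjection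
`A / B → A' / B'`. -/
theorem relLength_le_of_map {A B : Submodule R M} {A' B' : Submodule R N} (f : M →ₗ[R] N)
    (hA : ∀ a ∈ A, f a ∈ A') (hB : ∀ a ∈ A, a ∈ B → f a ∈ B')
    (hs : ∀ a' ∈ A', ∃ a ∈ A, f a - a' ∈ B') :
    relLength A' B' ≤ relLength A B := by
  refine relLength_ge_of_surjective ((B'.submoduleOf A').mkQ ∘ₗ f.restrict hA) ?_ ?_
  · intro a ha
    rw [LinearMap.comp_apply, Submodule.mkQ_apply, Submodule.Quotient.mk_eq_zero]
    exact hB a a.2 ha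
  · intro q
    obtain ⟨⟨a', ha'⟩, rfl⟩ := Submodule.Quotient.mk_surjective _ q
    obtain ⟨a, ha, h⟩ := hs a' ha'
    refine ⟨⟨a, ha⟩, ?_⟩
    rw [LinearMap.comp_apply, Submodule.mkQ_apply, Submodule.Quotient.eq]
    exact h

theorem relLength_anti {A B B' : Submodule R M} (h : B ≤ B') : relLength A B' ≤ relLength A B :=
  relLength_le_of_map LinearMap.id (fun _ h => h) (fun _ _ hb => h hb)
    (fun a ha => ⟨a, ha, by simp⟩)

theorem relLength_mono {A A' B : Submodule R M} (h : A ≤ A') : relLength A B ≤ relLength A' B :=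
  relLength_le_of_comap LinearMap.id (fun _ ha => h ha) (fun _ _ hb => hb)

theorem relLength_add {A B C : Submodule R M} (hCB : C ≤ B) (hBA : B ≤ A) :
    relLength A C = relLength A B + relLength B C := by
  have h₁ : C.submoduleOf B ≤ (C.submoduleOf A).comap (Submodule.inclusion hBA) := fun a ha => ha
  have h₂ : C.submoduleOf A ≤ B.submoduleOf A := fun a ha => hCB ha
  rw [add_comm]
  refine Module.length_eq_add_of_exact (Submodule.mapQ _ _ (Submodule.inclusion hBA) h₁)
    (Submodule.factor h₂) ?_ (Submodule.factor_surjective _) ?_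
  · rw [injective_iff_map_eq_zero]
    intro q hq
    obtain ⟨a, rfl⟩ := Submodule.Quotient.mk_surjective _ q
    exact (Submodule.Quotient.mk_eq_zero _).2 ((Submodule.Quotient.mk_eq_zero _).1 hq :)
  · intro q
    obtain ⟨a, rfl⟩ := Submodule.Quotient.mk_surjective _ q
    constructor
    · intro h
      exact ⟨Submodule.Quotient.mk ⟨a, ((Submodule.Quotient.mk_eq_zero _).1 h :)⟩, rfl⟩
    · rintro ⟨b, hb⟩
      obtain ⟨b, rfl⟩ := Submodule.Quotient.mk_surjective _ b
      rw [← hb]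
      exact (Submodule.Quotient.mk_eq_zero _).2 b.2

theorem relLength_eq_zero_of_le {A B : Submodule R M} (h : A ≤ B) : relLength A B = 0 := by
  rw [relLength, Module.length_eq_zero_iff, Submodule.Quotient.subsingleton_iff,
    Submodule.submoduleOf_eq_top]
  exact h

theorem one_le_relLength {A B : Submodule R M} (h : ¬ A ≤ B) : 1 ≤ relLength A B := by
  rw [Order.one_le_iff_ne_zero, relLength, Ne, Module.length_eq_zero_iff,
    Submodule.Quotient.subsingleton_iff, Submodule.submoduleOf_eq_top]
  exact h

end RelativeLength

/-! ### The Hilbert–Serre theorem for pairs of filtrations -/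

section HilbertSerre

/-- The summatory function of a polynomial is a polynomial (Faulhaber's formula). -/
theorem exists_polynomial_eval_eq_sum_range (Q : ℚ[X]) :
    ∃ P : ℚ[X], ∀ n : ℕ, P.eval (n : ℚ) = ∑ k ∈ Finset.range n, Q.eval (k : ℚ) := by
  induction Q using Polynomial.induction_on' with
  | add p q hp hq =>
    obtain ⟨P, hP⟩ := hp
    obtain ⟨P', hP'⟩ := hq
    exact ⟨P + P', fun n => by simp [hP, hP', Finset.sum_add_distrib]⟩
  | monomial m a =>
    refine ⟨C a * ∑ i ∈ Finset.range (m + 1),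
      C (_root_.bernoulli i * ((m + 1).choose i) / (m + 1)) * X ^ (m + 1 - i), fun n => ?_⟩
    have h : ∀ k : ℕ, ((monomial m a).eval (k : ℚ)) = a * (k : ℚ) ^ m := fun k => eval_monomial
    simp only [h]
    rw [← Finset.mul_sum, sum_range_pow, eval_C_mul, eval_finsetSum]
    congr 1
    refine Finset.sum_congr rfl fun i _ => ?_
    rw [eval_C_mul, eval_pow, eval_X]
    ring

/-- A function with eventually polynomial differences is eventually polynomial. -/
theorem exists_polynomial_of_sub_eq (f : ℕ → ℚ) (Q : ℚ[X]) (N : ℕ)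
    (h : ∀ n ≥ N, f (n + 1) - f n = Q.eval (n : ℚ)) :
    ∃ P : ℚ[X], ∀ n ≥ N, f n = P.eval (n : ℚ) := by
  obtain ⟨S, hS⟩ := exists_polynomial_eval_eq_sum_range Q
  refine ⟨S + C (f N - S.eval (N : ℚ)), fun n hn => ?_⟩
  induction n, hn using Nat.le_induction with
  | base => simp
  | succ n hn ih =>
    have h1 := h n hn
    rw [eval_add, eval_C, hS (n + 1), Finset.sum_range_succ, ← hS n]
    rw [eval_add, eval_C] at ih
    linarith

variable {R M : Type*} [CommRing R] [AddCommGroup M] [Module R M] {J : Ideal R}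

/-- The `J`-filtration `n ↦ {a ∈ Aₙ | x a ∈ Bₙ₊₁}`. -/
def kerFiltration (A B : J.Filtration M) (x : R) : J.Filtration M where
  N n := A.N n ⊓ (B.N (n + 1)).comap (LinearMap.lsmul R M x)
  mono n := inf_le_inf (A.mono n) (Submodule.comap_mono (B.mono (n + 1)))
  smul_le n := by
    refine Submodule.smul_le.2 fun r hr a ha => ?_
    refine ⟨A.smul_le n (Submodule.smul_mem_smul hr ha.1), ?_⟩
    have h : r • x • a ∈ B.N (n + 1 + 1) := B.smul_le (n + 1) (Submodule.smul_mem_smul hr ha.2)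
    rwa [smul_comm] at h

/-- The `J`-filtration `n ↦ x Aₙ + Bₙ₊₁`. -/
def cokerFiltration (A B : J.Filtration M) (x : R) : J.Filtration M where
  N n := (A.N n).map (LinearMap.lsmul R M x) ⊔ B.N (n + 1)
  mono n := sup_le_sup (Submodule.map_mono (A.mono n)) (B.mono (n + 1))
  smul_le n := by
    rw [Submodule.smul_sup, ← Submodule.map_smul'']
    exact sup_le_sup (Submodule.map_mono (A.smul_le n)) (B.smul_le (n + 1))

/-- The `J`-filtration `n ↦ Aₙ₊₁`. -/
def shiftFiltration (A : J.Filtration M) : J.Filtration M where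
  N n := A.N (n + 1)
  mono n := A.mono (n + 1)
  smul_le n := A.smul_le (n + 1)

/-- The exact sequence `0 → K → Aₙ / Bₙ → Aₙ₊₁ / Bₙ₊₁ → C → 0` given by multiplication by `x ∈ J`,
in terms of lengths. -/
theorem relLength_succ_add (A B : J.Filtration M) (hBA : ∀ n, B.N n ≤ A.N n) {x : R} (hx : x ∈ J)
    (n : ℕ) :
    relLength (A.N (n + 1)) (B.N (n + 1)) + relLength ((kerFiltration A B x).N n) (B.N n) =
      relLength (A.N n) (B.N n) +
        relLength ((shiftFiltration A).N n) ((cokerFiltration A B x).N n) := by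
  have hxA : (A.N n).map (LinearMap.lsmul R M x) ≤ A.N (n + 1) := by
    rintro _ ⟨a, ha, rfl⟩
    exact A.smul_le n (Submodule.smul_mem_smul hx ha)
  have h1 : relLength (A.N (n + 1)) (B.N (n + 1)) =
      relLength (A.N (n + 1)) ((cokerFiltration A B x).N n) +
        relLength ((cokerFiltration A B x).N n) (B.N (n + 1)) :=
    relLength_add le_sup_right (sup_le hxA (hBA (n + 1)))
  have h2 : relLength (A.N n) (B.N n) = relLength (A.N n) ((kerFiltration A B x).N n) +
      relLength ((kerFiltration A B x).N n) (B.N n) :=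
    relLength_add (le_inf (hBA n) fun b hb => B.smul_le n (Submodule.smul_mem_smul hx hb))
      inf_le_left
  have h3 : relLength ((cokerFiltration A B x).N n) (B.N (n + 1)) =
      relLength (A.N n) ((kerFiltration A B x).N n) := by
    apply le_antisymm
    · refine relLength_le_of_map (LinearMap.lsmul R M x)
        (fun a ha => Submodule.mem_sup_left ⟨a, ha, rfl⟩) (fun a _ ha => ha.2) fun c hc => ?_
      obtain ⟨_, ⟨a, ha, rfl⟩, b, hb, rfl⟩ := Submodule.mem_sup.1 hc
      exact ⟨a, ha, by simpa using hb⟩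
    · exact relLength_le_of_comap (LinearMap.lsmul R M x)
        (fun a ha => Submodule.mem_sup_left ⟨a, ha, rfl⟩) fun a ha hb => ⟨ha, hb⟩
  rw [h1, h2, h3]
  change _ = _ + relLength (A.N (n + 1)) _
  abel

/-- **Hilbert–Serre** for a pair of `J`-filtrations: if `A` is stable and the lengths of `Aₙ / Bₙ`
are finite for large `n`, they agree with a polynomial for large `n`. The induction is on the number
of generators `x` of `J` which do not satisfy `x Aₙ ⊆ Bₙ₊₁` for all `n`. -/
theorem exists_polynomial_relLength_of_subset [IsNoetherianRing R] [Module.Finite R M]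
    (S : Finset R) (hS : Ideal.span (S : Set R) = J) (T : Finset R) (hTS : T ⊆ S) :
    ∀ (A B : J.Filtration M), A.Stable → (∀ n, B.N n ≤ A.N n) →
      (∀ᶠ n in atTop, relLength (A.N n) (B.N n) < ⊤) →
      (∀ x ∈ S, x ∉ T → ∀ n, ∀ a ∈ A.N n, x • a ∈ B.N (n + 1)) →
      ∃ P : ℚ[X], ∀ᶠ n : ℕ in atTop, ∃ k : ℕ, relLength (A.N n) (B.N n) = k ∧
        P.eval (n : ℚ) = k := by
  classical
  induction T using Finset.induction_on with
  | empty =>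
    intro A B hA hBA hfin h
    -- all generators of `J` carry `Aₙ` into `Bₙ₊₁`, so `Aₙ₊₁ = J Aₙ ⊆ Bₙ₊₁` for large `n`
    obtain ⟨n₀, hn₀⟩ := hA
    refine ⟨0, eventually_atTop.2 ⟨n₀ + 1, fun n hn => ⟨0, ?_, by simp⟩⟩⟩
    obtain ⟨n, rfl⟩ : ∃ m, n = m + 1 := ⟨n - 1, by omega⟩
    rw [Nat.cast_zero]
    apply relLength_eq_zero_of_le
    rw [← hn₀ n (by omega), Submodule.smul_le]
    intro r hr a ha
    have : Ideal.span (S : Set R) ≤ (B.N (n + 1)).comap (LinearMap.toSpanSingleton R M a) :=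
      Ideal.span_le.2 fun x hx => h x hx (by simp) n a ha
    exact this (hS ▸ hr)
  | insert x T hxT ih =>
    intro A B hA hBA hfin h
    have hxS : x ∈ S := hTS (Finset.mem_insert_self x T)
    have hxJ : x ∈ J := hS ▸ Ideal.subset_span hxS
    have ih' := ih ((Finset.subset_insert x T).trans hTS)
    obtain ⟨n₀, hn₀⟩ := eventually_atTop.1 hfin
    have key := relLength_succ_add A B hBA hxJ
    have hshift : (shiftFiltration A).Stable := by
      obtain ⟨m, hm⟩ := hA
      exact ⟨m, fun n hn => hm (n + 1) (by omega)⟩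
    -- `x` acts trivially on both the kernel and the cokernel of multiplication by `x`
    obtain ⟨P₁, hP₁⟩ := ih' (kerFiltration A B x) B
      (hA.of_le fun n => inf_le_left)
      (fun n => le_inf (hBA n) fun b hb => B.smul_le n (Submodule.smul_mem_smul hxJ hb))
      (eventually_atTop.2 ⟨n₀, fun n hn => (relLength_mono inf_le_left).trans_lt (hn₀ n hn)⟩)
      (fun y hy hyT n a ha => by
        by_cases hyx : y = x
        · subst hyx
          exact ha.2
        · exact h y hy (by simp [hyx, hyT]) n a ha.1)
    obtain ⟨P₂, hP₂⟩ := ih' (shiftFiltration A) (cokerFiltration A B x) hshift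
      (fun n => sup_le (by
        rintro _ ⟨a, ha, rfl⟩
        exact A.smul_le n (Submodule.smul_mem_smul hxJ ha)) (hBA (n + 1)))
      (eventually_atTop.2 ⟨n₀, fun n hn =>
        (relLength_anti le_sup_right).trans_lt (hn₀ (n + 1) (by omega))⟩)
      (fun y hy hyT n a ha => by
        by_cases hyx : y = x
        · subst hyx
          exact Submodule.mem_sup_left ⟨a, ha, rfl⟩
        · exact Submodule.mem_sup_right (h y hy (by simp [hyx, hyT]) (n + 1) a ha))
    obtain ⟨N, hN⟩ := eventually_atTop.1 ((hP₁.and hP₂).and (eventually_ge_atTop n₀))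
    obtain ⟨P, hP⟩ := exists_polynomial_of_sub_eq
      (fun n => ((relLength (A.N n) (B.N n)).toNat : ℚ)) (P₂ - P₁) N (fun n hn => by
        obtain ⟨⟨⟨k₁, hk₁, e₁⟩, ⟨k₂, hk₂, e₂⟩⟩, hn'⟩ := hN n hn
        obtain ⟨a, ha⟩ := ENat.ne_top_iff_exists.1 (hn₀ n hn').ne
        obtain ⟨b, hb⟩ := ENat.ne_top_iff_exists.1 (hn₀ (n + 1) (by omega)).ne
        have hk := key n
        rw [hk₁, hk₂, ← ha, ← hb] at hk
        have hk' : b + k₁ = a + k₂ := by exact_mod_cast hk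
        have hk'' : (b : ℚ) + k₁ = a + k₂ := by exact_mod_cast hk'
        simp only [← ha, ← hb, ENat.toNat_natCast]
        rw [eval_sub, e₁, e₂]
        linarith)
    refine ⟨P, eventually_atTop.2 ⟨N, fun n hn => ?_⟩⟩
    have hlt := hn₀ n (hN n hn).2
    exact ⟨_, (ENat.natCast_toNat hlt.ne).symm, (hP n hn).symm⟩

theorem exists_polynomial_relLength [IsNoetherianRing R] [Module.Finite R M]
    (A B : J.Filtration M) (hA : A.Stable) (hBA : ∀ n, B.N n ≤ A.N n)
    (hfin : ∀ᶠ n in atTop, relLength (A.N n) (B.N n) < ⊤) :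
    ∃ P : ℚ[X], ∀ᶠ n : ℕ in atTop, ∃ k : ℕ, relLength (A.N n) (B.N n) = k ∧
      P.eval (n : ℚ) = k := by
  obtain ⟨S, hS⟩ := IsNoetherian.noetherian J
  exact exists_polynomial_relLength_of_subset S hS S subset_rfl A B hA hBA hfin
    fun x hx hx' => absurd hx hx'

end HilbertSerre

/-! ### Degrees of polynomials from growth -/

section Degree

theorem neg_one_le_polyDegree (P : ℚ[X]) : -1 ≤ polyDegree P := by
  unfold polyDegree
  split_ifs <;> omega

theorem natDegree_le_of_eventually_abs_le (Q : ℚ[X]) (l : ℕ) (c : ℚ)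
    (h : ∀ᶠ n : ℕ in atTop, |Q.eval (n : ℚ)| ≤ c * ((n : ℚ) + 1) ^ l) : Q.natDegree ≤ l := by
  by_contra! hl
  have hB : ((X + 1 : ℚ[X]) ^ l) ≠ 0 := (monic_X_add_C (1 : ℚ)).pow l |>.ne_zero
  have hdeg : ((X + 1 : ℚ[X]) ^ l).degree < Q.degree := by
    apply degree_lt_degree
    rwa [natDegree_pow, show (X + 1 : ℚ[X]) = X + C 1 by simp, natDegree_X_add_C, mul_one]
  have ht := (abs_div_tendsto_atTop_atTop_of_degree_gt Q _ hdeg hB).comp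
    (tendsto_natCast_atTop_atTop (R := ℚ))
  obtain ⟨n, hn, hn'⟩ := ((ht.eventually_gt_atTop c).and h).exists
  have hpos : (0 : ℚ) < ((n : ℚ) + 1) ^ l := by positivity
  rw [Function.comp_apply, abs_div] at hn
  simp only [eval_pow, eval_add, eval_X, eval_one, abs_of_pos hpos] at hn
  rw [lt_div_iff₀ hpos] at hn
  exact absurd hn' (not_le.2 hn)

/-- The summatory function of a nonzero polynomial of degree `d` is a polynomial of degree at
least `d + 1`. -/
theorem polyDegree_le_of_sum_le (P : ℚ[X]) (l : ℕ) (c : ℚ)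
    (h : ∀ᶠ n : ℕ in atTop,
      |∑ k ∈ Finset.range n, P.eval (k : ℚ)| ≤ c * ((n : ℚ) + 1) ^ l) :
    polyDegree P ≤ (l : ℤ) - 1 := by
  unfold polyDegree
  split_ifs with hP
  · omega
  obtain ⟨S, hS⟩ := exists_polynomial_eval_eq_sum_range P
  have hSl : S.natDegree ≤ l := natDegree_le_of_eventually_abs_le S l c (by simpa only [hS] using h)
  have hPS : P = S.comp (X + C 1) - S := by
    apply Polynomial.eq_of_infinite_eval_eq
    refine (Set.infinite_range_of_injective (Nat.cast_injective (R := ℚ))).mono ?_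
    rintro _ ⟨n, rfl⟩
    have h1 := hS (n + 1)
    rw [Finset.sum_range_succ, ← hS n] at h1
    push_cast at h1
    simp only [Set.mem_ofPred_eq, eval_sub, eval_comp, eval_add, eval_X, eval_C, h1]
    ring
  have hS0 : S ≠ 0 := by
    rintro rfl
    simp at hPS
    exact hP hPS
  have hcomp : (S.comp (X + C 1)).natDegree = S.natDegree := by
    rw [natDegree_comp, natDegree_X_add_C, mul_one]
  have hX : (X + C (1 : ℚ)).natDegree ≠ 0 := by rw [natDegree_X_add_C]; exact one_ne_zero
  have hlead : (S.comp (X + C 1)).leadingCoeff = S.leadingCoeff := by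
    rw [leadingCoeff_comp hX, leadingCoeff_X_add_C, one_pow, mul_one]
  have hcomp0 : S.comp (X + C 1) ≠ 0 := by
    rwa [← leadingCoeff_ne_zero, hlead, leadingCoeff_ne_zero]
  have hlt : P.degree < S.degree := by
    have := degree_sub_lt_left (p := S.comp (X + C 1)) (q := S)
      (by rw [degree_eq_natDegree hcomp0, degree_eq_natDegree hS0, hcomp]) hcomp0 hlead
    rw [← hPS, degree_eq_natDegree hcomp0, hcomp, ← degree_eq_natDegree hS0] at this
    exact this
  have := natDegree_lt_natDegree hP hlt
  omega

theorem multichoose_succ_eq_choose (g k : ℕ) : (g + 1).multichoose k = (g + k).choose g := by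
  rw [Nat.multichoose_eq, Nat.add_right_comm, Nat.add_sub_cancel, ← Nat.choose_symm_add]

/-- `g.multichoose k`, the number of monomials of degree `k` in `g` variables, grows as
`k ^ (g - 1)`; it vanishes for `g = 0` and `k > 0`, which fits the degree `-1` of zero. -/
theorem le_polyDegree_of_multichoose_le (P : ℚ[X]) (g D : ℕ)
    (h : ∀ᶠ k : ℕ in atTop, (g.multichoose k : ℚ) ≤ P.eval ((1 + D * k : ℕ) : ℚ)) :
    (g : ℤ) - 1 ≤ polyDegree P := by
  rcases g with _ | g
  · simpa using neg_one_le_polyDegree P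
  have hmc : ∀ k : ℕ, ((k : ℚ) + 1) ^ g / (g.factorial : ℚ) ≤ ((g + 1).multichoose k : ℚ) := by
    intro k
    rw [multichoose_succ_eq_choose]
    refine le_trans (le_of_eq ?_) (Nat.pow_le_choose g (g + k))
    rw [show g + k + 1 - g = k + 1 by omega]
    push_cast
    rfl
  have hP : P ≠ 0 := by
    rintro rfl
    obtain ⟨k, hk⟩ := h.exists
    have h1 := (hmc k).trans hk
    have : (0 : ℚ) < ((k : ℚ) + 1) ^ g / (g.factorial : ℚ) := by positivity
    rw [eval_zero] at h1
    linarith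
  rw [polyDegree, if_neg hP]
  suffices g ≤ P.natDegree by
    push_cast
    omega
  by_contra! hlt
  set Q := P.comp (C (D : ℚ) * X + C 1) with hQ
  have hQdeg : Q.natDegree < g := by
    refine lt_of_le_of_lt natDegree_comp_le (lt_of_le_of_lt ?_ hlt)
    exact (Nat.mul_le_mul_left _ natDegree_linear_le).trans (by simp)
  have hB : Q.degree < ((X + C 1 : ℚ[X]) ^ g).degree := by
    apply degree_lt_degree
    rwa [natDegree_pow, natDegree_X_add_C, mul_one]
  have ht := (div_tendsto_atTop_zero_of_degree_lt Q _ hB).comp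
    (tendsto_natCast_atTop_atTop (R := ℚ))
  have hfac : (0 : ℚ) < 1 / (g.factorial : ℚ) := by positivity
  obtain ⟨k, hk, hk'⟩ := ((ht.eventually_lt_const hfac).and h).exists
  have hpos : (0 : ℚ) < ((k : ℚ) + 1) ^ g := by positivity
  have h1 := (hmc k).trans hk'
  have h2 : Q.eval (k : ℚ) = P.eval ((1 + D * k : ℕ) : ℚ) := by
    rw [hQ, eval_comp]
    congr 1
    simp
    ring
  rw [Function.comp_apply, h2] at hk
  simp only [eval_pow, eval_add, eval_X, eval_C] at hk
  rw [div_lt_iff₀ hpos, one_div_mul_eq_div] at hk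
  exact absurd h1 (not_le.2 hk)

end Degree

/-! ### Existence of the polynomial -/

section ReesPolynomial

variable {R : Type*} [CommRing R] {I J : Ideal R}

/-- The filtration of `I` by its powers, as a `J`-filtration for `J ⊆ I`. -/
def powFiltration (I J : Ideal R) (h : J ≤ I) : J.Filtration R where
  N n := I ^ n
  mono n := Ideal.pow_le_pow_right n.le_succ
  smul_le n := by
    rw [smul_eq_mul, pow_succ']
    exact Ideal.mul_mono_left h

theorem IsReduction.exists_pow_add_eq (h : IsReduction J I) :
    ∃ n₀, ∀ n ≥ n₀, ∀ j, I ^ (n + j) = J ^ j * I ^ n := by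
  obtain ⟨hJI, n₀, hn₀⟩ := h
  have h1 : ∀ n ≥ n₀, J * I ^ n = I ^ (n + 1) := by
    intro n hn
    obtain ⟨m, rfl⟩ := Nat.exists_eq_add_of_le hn
    rw [pow_add, ← mul_assoc, hn₀, ← pow_add]
    ring_nf
  refine ⟨n₀, fun n hn j => ?_⟩
  induction j with
  | zero => simp
  | succ j ih => rw [← add_assoc, ← h1 _ (by omega), ih, pow_succ', mul_assoc]

theorem IsReduction.exists_isReesPolynomial [IsNoetherianRing R] (h : IsReduction J I)
    (hfin : ∀ᶠ n in atTop, powQuotLength I J n < ⊤) : ∃ P, IsReesPolynomial I J P := by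
  refine exists_polynomial_relLength (powFiltration I J h.1) (powFiltration J J le_rfl) ?_
    (fun n => Ideal.pow_right_mono h.1 n) hfin
  obtain ⟨n₀, hn₀⟩ := h.exists_pow_add_eq
  refine ⟨n₀, fun n hn => ?_⟩
  change J • I ^ n = I ^ (n + 1)
  rw [hn₀ n hn 1, pow_one, smul_eq_mul]

end ReesPolynomial

/-! ### Multiplication by an element regular on powers -/

section LowerBoundStep

variable {R : Type*} [CommRing R] {I J : Ideal R}

/-- If `x ∈ Jᵉ` and `Jⁿ⁺ᵉ : x = Jⁿ` for all `n`, multiplication by `x` embeds `Iⁿ / Jⁿ` in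
`Iⁿ⁺ᵉ / Jⁿ⁺ᵉ`, and the cokernel surjects onto the corresponding quotient over `R / x`. -/
theorem powQuotLength_add_le (hJI : J ≤ I) {x : R} {e : ℕ} (hx : x ∈ J ^ e)
    (hreg : ∀ n r, x * r ∈ J ^ (n + e) → r ∈ J ^ n) (n : ℕ) :
    powQuotLength I J n + powQuotLength (I.map (Ideal.Quotient.mk (Ideal.span {x})))
      (J.map (Ideal.Quotient.mk (Ideal.span {x}))) (n + e) ≤ powQuotLength I J (n + e) := by
  set q := Ideal.Quotient.mk (Ideal.span {x})
  set B : Ideal R := Ideal.span {x} * I ^ n ⊔ J ^ (n + e) with hB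
  have hBI : B ≤ I ^ (n + e) := by
    refine sup_le ?_ (Ideal.pow_right_mono hJI _)
    rw [pow_add, mul_comm]
    exact Ideal.mul_mono_right ((Ideal.span_singleton_le_iff_mem _).2
      (Ideal.pow_right_mono hJI e hx))
  have h1 : powQuotLength I J (n + e) = relLength (I ^ (n + e)) B + relLength B (J ^ (n + e)) :=
    relLength_add le_sup_right hBI
  have h2 : powQuotLength I J n ≤ relLength B (J ^ (n + e)) := by
    refine relLength_le_of_comap (LinearMap.lsmul R R x) (fun a ha => ?_)
      (fun a _ ha => hreg n a ha)
    exact Submodule.mem_sup_left (Ideal.mul_mem_mul (Ideal.mem_span_singleton_self x) ha)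
  have h3 : powQuotLength (I.map q) (J.map q) (n + e) ≤ relLength (I ^ (n + e)) B := by
    have hmem : ∀ a ∈ I ^ (n + e), q a ∈ (I.map q) ^ (n + e) := fun a ha => by
      rw [← Ideal.map_pow]
      exact Ideal.mem_map_of_mem q ha
    let f : ↥(I ^ (n + e)) →ₗ[R] ↥((I.map q) ^ (n + e)) :=
      { toFun := fun a => ⟨q a, hmem a a.2⟩
        map_add' := fun a b => rfl
        map_smul' := fun a b => rfl }
    rw [powQuotLength, ← Module.length_eq_of_surjective (S := R) Ideal.Quotient.mk_surjective]
    refine relLength_ge_of_surjective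
      ((Submodule.mkQ (Submodule.submoduleOf ((J.map q) ^ (n + e)) ((I.map q) ^ (n + e)))
        ).restrictScalars R ∘ₗ f) (fun a ha => ?_) ?_
    · refine (Submodule.Quotient.mk_eq_zero _).2 ?_
      change q a ∈ (J.map q) ^ (n + e)
      have : B ≤ ((J.map q) ^ (n + e)).comap q := by
        refine sup_le ?_ ?_
        · refine Ideal.mul_le_left.trans ?_
          rw [Ideal.span_singleton_le_iff_mem, Ideal.mem_comap,
            Ideal.Quotient.eq_zero_iff_mem.2 (Ideal.mem_span_singleton_self x)]
          exact zero_mem _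
        · rw [← Ideal.map_pow]
          exact Ideal.le_comap_map
      exact this ha
    · refine (Submodule.mkQ_surjective _).comp ?_
      rintro ⟨y, hy⟩
      have hy' := hy
      rw [← Ideal.map_pow] at hy'
      obtain ⟨a, ha, rfl⟩ := (Ideal.mem_map_iff_of_surjective q Ideal.Quotient.mk_surjective).1 hy'
      exact ⟨⟨a, ha⟩, rfl⟩
  rw [h1, add_comm]
  exact add_le_add h3 h2

theorem map_mk_lt_map_mk (hJI : J < I) {K : Ideal R} (hK : K ≤ J) :
    J.map (Ideal.Quotient.mk K) < I.map (Ideal.Quotient.mk K) := by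
  refine lt_of_le_not_ge (Ideal.map_mono hJI.le) fun h => hJI.not_ge ?_
  have := Ideal.comap_mono (f := Ideal.Quotient.mk K) h
  rw [Ideal.comap_map_of_surjective' _ Ideal.Quotient.mk_surjective,
    Ideal.comap_map_of_surjective' _ Ideal.Quotient.mk_surjective, Ideal.mk_ker,
    sup_eq_left.2 hK] at this
  exact le_sup_left.trans this

theorem one_le_powQuotLength_one (hJI : J < I) : 1 ≤ powQuotLength I J 1 := by
  rw [powQuotLength_eq_relLength, pow_one, pow_one]
  exact one_le_relLength hJI.not_ge

/-- One step of the lower bound: the growth of `λ(Iⁿ / Jⁿ)` exceeds that over `R / x` by one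
degree. Along `n = 1 + D k` the values of `Nat.multichoose`, which count monomials, are a lower
bound that propagates without any finiteness assumption. -/
theorem exists_multichoose_succ_le (hJI : J < I) {x : R} {e : ℕ} (he : 1 ≤ e) (hx : x ∈ J ^ e)
    (hreg : ∀ n r, x * r ∈ J ^ (n + e) → r ∈ J ^ n) {g : ℕ}
    (h : ∃ D, 1 ≤ D ∧ ∀ k, (g.multichoose k : ℕ∞) ≤
      powQuotLength (I.map (Ideal.Quotient.mk (Ideal.span {x})))
        (J.map (Ideal.Quotient.mk (Ideal.span {x}))) (1 + D * k)) :
    ∃ D, 1 ≤ D ∧ ∀ k, ((g + 1).multichoose k : ℕ∞) ≤ powQuotLength I J (1 + D * k) := by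
  obtain ⟨D, hD, h⟩ := h
  have hstep := powQuotLength_add_le hJI.le hx hreg
  have hmono : ∀ n j, powQuotLength I J n ≤ powQuotLength I J (n + j * e) := by
    intro n j
    induction j with
    | zero => simp
    | succ j ih =>
      rw [Nat.succ_mul, ← add_assoc]
      exact ih.trans (le_self_add.trans (hstep _))
  have hcoeff : ∀ k, g.multichoose (k + 1) ≤ g.multichoose (e * (k + 1)) := by
    intro k
    have hk : k + 1 ≤ e * (k + 1) := Nat.le_mul_of_pos_left _ he
    rcases g with _ | g
    · rw [Nat.multichoose_zero_succ]
      exact Nat.zero_le _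
    · rw [multichoose_succ_eq_choose, multichoose_succ_eq_choose]
      exact Nat.choose_le_choose g (Nat.add_le_add_left hk g)
  refine ⟨D * e, Nat.mul_pos hD he, fun k => ?_⟩
  induction k with
  | zero => simpa using one_le_powQuotLength_one hJI
  | succ k ih =>
    -- the argument `1 + D e (k + 1)` is reached from `1 + D e k` by `D` steps of length `e`; the
    -- last one contributes the summand over `R / x`, the others are only used to be monotone
    obtain ⟨d, rfl⟩ : ∃ d, D = d + 1 := ⟨D - 1, by omega⟩
    have e1 : 1 + (d + 1) * e * (k + 1) = (1 + (d + 1) * e * k + d * e) + e := by ring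
    have e2 : 1 + (d + 1) * e * (k + 1) = 1 + (d + 1) * (e * (k + 1)) := by ring
    rw [Nat.multichoose_succ_succ, Nat.cast_add, add_comm, e1]
    refine le_trans (add_le_add (ih.trans (hmono _ d)) ?_) (hstep _)
    rw [← e1, e2]
    exact le_trans (by exact_mod_cast hcoeff k) (h _)

end LowerBoundStep

/-! ### Homogeneous prime avoidance -/

section Avoidance

/-- **Homogeneous prime avoidance**, for a multiplicative family `𝒜` of homogeneous components:
if each of finitely many primes misses some homogeneous element of positive degree, then all of
them miss a common one. -/
theorem exists_homogeneous_notMem {A : Type*} [CommRing A] (𝒜 : ℕ → Set A)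
    (hadd : ∀ n, ∀ y ∈ 𝒜 n, ∀ z ∈ 𝒜 n, y + z ∈ 𝒜 n)
    (hmul : ∀ n m, ∀ y ∈ 𝒜 n, ∀ z ∈ 𝒜 m, y * z ∈ 𝒜 (n + m)) (s : Finset (Ideal A))
    (hs : ∀ P ∈ s, P.IsPrime ∧ ∃ e, 1 ≤ e ∧ ∃ z ∈ 𝒜 e, z ∉ P) (h0 : 0 ∈ 𝒜 1) :
    ∃ e, 1 ≤ e ∧ ∃ z ∈ 𝒜 e, ∀ P ∈ s, z ∉ P := by
  classical
  induction s using Finset.strongInduction with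
  | H s ih =>
  have hpow : ∀ n, ∀ y ∈ 𝒜 n, ∀ m, 1 ≤ m → y ^ m ∈ 𝒜 (m * n) := by
    intro n y hy m hm
    induction m, hm using Nat.le_induction with
    | base => simpa using hy
    | succ m _ ihm =>
      rw [pow_succ, Nat.succ_mul]
      exact hmul _ _ _ ihm _ hy
  rcases s.eq_empty_or_nonempty with rfl | ⟨Q, hQ⟩
  · exact ⟨1, le_rfl, 0, h0, by simp⟩
  -- a prime whose homogeneous elements of positive degree all lie in another one can be dropped
  by_cases hcomp : ∃ P ∈ s, ∃ P' ∈ s, P ≠ P' ∧ ∀ e, 1 ≤ e → ∀ z ∈ 𝒜 e, z ∈ P → z ∈ P'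
  · obtain ⟨P, hP, P', hP', hne, hle⟩ := hcomp
    obtain ⟨e, he, z, hz, hzs⟩ := ih (s.erase P) (Finset.erase_ssubset hP)
      fun T hT => hs T (Finset.mem_of_mem_erase hT)
    refine ⟨e, he, z, hz, fun T hT hzT => ?_⟩
    by_cases hTP : T = P
    · subst hTP
      exact hzs P' (Finset.mem_erase.2 ⟨hne.symm, hP'⟩) (hle e he z hz hzT)
    · exact hzs T (Finset.mem_erase.2 ⟨hTP, hT⟩) hzT
  · push Not at hcomp
    obtain ⟨e, he, x, hx, hxs⟩ := ih (s.erase Q) (Finset.erase_ssubset hQ)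
      fun T hT => hs T (Finset.mem_of_mem_erase hT)
    by_cases hxQ : x ∉ Q
    · refine ⟨e, he, x, hx, fun T hT => ?_⟩
      by_cases hTQ : T = Q
      · exact hTQ ▸ hxQ
      · exact hxs T (Finset.mem_erase.2 ⟨hTQ, hT⟩)
    push Not at hxQ
    have := (hs Q hQ).1
    -- `x` lies in `Q` only, and `y` in all primes but `Q`: combine powers of them of equal degree
    have hy : ∀ t ⊆ s.erase Q, ∃ f, 1 ≤ f ∧ ∃ y ∈ 𝒜 f, y ∉ Q ∧ ∀ P ∈ t, y ∈ P := by
      intro t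
      induction t using Finset.induction_on with
      | empty =>
        intro _
        obtain ⟨f, hf, y, hy, hyQ⟩ := (hs Q hQ).2
        exact ⟨f, hf, y, hy, hyQ, by simp⟩
      | insert P t _ iht =>
        intro ht
        obtain ⟨f, hf, y, hy, hyQ, hyt⟩ := iht ((Finset.subset_insert P t).trans ht)
        obtain ⟨hPQ, hPs⟩ := Finset.mem_erase.1 (ht (Finset.mem_insert_self P t))
        obtain ⟨d, hd, u, hu, huP, huQ⟩ := hcomp P hPs Q hQ hPQ
        refine ⟨d + f, by omega, u * y, hmul _ _ _ hu _ hy,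
          fun h => (this.mem_or_mem h).elim huQ hyQ, fun T hT => ?_⟩
        rcases Finset.mem_insert.1 hT with rfl | hT
        · exact Ideal.mul_mem_right _ _ huP
        · exact Ideal.mul_mem_left _ _ (hyt T hT)
    obtain ⟨f, hf, y, hy, hyQ, hys⟩ := hy _ subset_rfl
    refine ⟨f * e, Nat.mul_pos hf he, x ^ f + y ^ e, ?_, fun T hT hmem => ?_⟩
    · exact hadd _ _ (hpow _ _ hx f hf) _ (mul_comm e f ▸ hpow _ _ hy e he)
    · by_cases hTQ : T = Q
      · subst hTQ
        exact hyQ (this.mem_of_pow_mem e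
          ((Ideal.add_mem_iff_right _ (Ideal.pow_mem_of_mem _ hxQ f hf)).1 hmem))
      · have hT' := Finset.mem_erase.2 ⟨hTQ, hT⟩
        exact hxs T hT' ((hs T hT).1.mem_of_pow_mem f
          ((Ideal.add_mem_iff_left _ (Ideal.pow_mem_of_mem _ (hys T hT') e he)).1 hmem))

end Avoidance

/-! ### Exchanging elements of regular sequences -/

section RegularSequences

open RingTheory.Sequence Submodule Pointwise

variable {A M : Type*} [CommRing A] [AddCommGroup M] [Module A M]

/-- If `ξ` is regular on `M / a M` and `a` is regular on `M`, then `a` is regular on `M / ξ M`; the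
regularity of `ξ` on `M` is not needed. -/
theorem isSMulRegular_quotSMulTop_swap {a ξ : A} (ha : IsSMulRegular M a)
    (hξ : IsSMulRegular (QuotSMulTop a M) ξ) : IsSMulRegular (QuotSMulTop ξ M) a := by
  rw [isSMulRegular_quotient_iff_mem_of_smul_mem] at hξ ⊢
  intro m hm
  obtain ⟨n, -, hn⟩ := (mem_smul_pointwise_iff_exists _ _ _).1 hm
  have hn' : ξ • n ∈ a • (⊤ : Submodule A M) := by
    rw [hn]
    exact smul_mem_pointwise_smul _ _ _ mem_top
  obtain ⟨n', -, rfl⟩ := (mem_smul_pointwise_iff_exists _ _ _).1 (hξ n hn')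
  rw [smul_comm] at hn
  rw [← ha hn]
  exact smul_mem_pointwise_smul _ _ _ mem_top

theorem isWeaklyRegular_swap_head {a ξ : A} {rs : List A} (h : IsWeaklyRegular M (a :: ξ :: rs))
    (hξ : IsSMulRegular M ξ) : IsWeaklyRegular M (ξ :: a :: rs) := by
  have h1 := h
  rw [isWeaklyRegular_cons_iff, isWeaklyRegular_cons_iff] at h1
  have h2 : IsWeaklyRegular M ([a, ξ] ++ rs) := h
  change IsWeaklyRegular M ([ξ, a] ++ rs)
  rw [isWeaklyRegular_append_iff] at h2 ⊢
  refine ⟨.cons hξ ((isWeaklyRegular_singleton_iff _ _).2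
    (isSMulRegular_quotSMulTop_swap h1.1 h1.2.1)), ?_⟩
  have : Ideal.ofList [ξ, a] = Ideal.ofList [a, ξ] := by simp [sup_comm]
  rw [this]
  exact h2.2

theorem _root_.IsSMulRegular.notMem_of_mem_associatedPrimes [IsNoetherianRing A] {a : A}
    (ha : IsSMulRegular M a) {P : Ideal A} (hP : P ∈ associatedPrimes A M) : a ∉ P := by
  intro haP
  have : a ∈ ⋃ p ∈ associatedPrimes A M, (p : Set A) := Set.mem_biUnion hP haP
  rw [biUnion_associatedPrimes_eq_compl_regular] at this
  exact this ha

theorem isSMulRegular_of_forall_notMem [IsNoetherianRing A] {ξ : A}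
    (h : ∀ P ∈ associatedPrimes A M, ξ ∉ P) : IsSMulRegular M ξ := by
  by_contra hξ
  have : ξ ∈ {r : A | IsSMulRegular M r}ᶜ := hξ
  rw [← biUnion_associatedPrimes_eq_compl_regular] at this
  obtain ⟨P, hP, hξP⟩ := Set.mem_iUnion₂.1 this
  exact h P hP hξP

/-- In a weakly regular sequence contained in `𝔞`, one element can be exchanged for any `ξ` outside
a finite set of primes, none of which contains `𝔞`, and `ξ` can then be put first. -/
theorem exists_finset_forall_notMem [IsNoetherianRing A] (𝔞 : Ideal A) (g : ℕ) (rs : List A)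
    (M : Type*) [AddCommGroup M] [Module A M] [Module.Finite A M] (hlen : rs.length = g + 1)
    (hrs : ∀ x ∈ rs, x ∈ 𝔞) (h : IsWeaklyRegular M rs) :
    ∃ s : Finset (Ideal A), (∀ P ∈ s, P.IsPrime ∧ ¬ 𝔞 ≤ P) ∧ ∀ ξ, (∀ P ∈ s, ξ ∉ P) →
      ∃ rs' : List A, rs'.length = g ∧ (∀ x ∈ rs', x ∈ 𝔞) ∧ IsWeaklyRegular M (ξ :: rs') := by
  classical
  induction g generalizing rs M with
  | zero =>
    obtain ⟨a, rfl⟩ := List.length_eq_one_iff.1 hlen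
    have ha := ((isWeaklyRegular_cons_iff _ _ _).1 h).1
    refine ⟨(associatedPrimes.finite A M).toFinset, fun P hP => ?_, fun ξ hξ => ⟨[], rfl, by simp,
      (isWeaklyRegular_singleton_iff _ _).2 ?_⟩⟩
    · rw [Set.Finite.mem_toFinset] at hP
      exact ⟨hP.isPrime, fun hle => ha.notMem_of_mem_associatedPrimes hP (hle (hrs a (by simp)))⟩
    · exact isSMulRegular_of_forall_notMem fun P hP => hξ P (by simpa using hP)
  | succ g ih =>
    obtain ⟨a, rs, rfl⟩ := List.exists_cons_of_length_eq_add_one hlen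
    obtain ⟨ha, h'⟩ := (isWeaklyRegular_cons_iff _ _ _).1 h
    obtain ⟨s, hs, hs'⟩ := ih rs (QuotSMulTop a M) (by simpa using hlen)
      (fun x hx => hrs x (List.mem_cons_of_mem a hx)) h'
    refine ⟨(associatedPrimes.finite A M).toFinset ∪ s, fun P hP => ?_, fun ξ hξ => ?_⟩
    · rcases Finset.mem_union.1 hP with hP | hP
      · rw [Set.Finite.mem_toFinset] at hP
        exact ⟨hP.isPrime, fun hle => ha.notMem_of_mem_associatedPrimes hP (hle (hrs a (by simp)))⟩
      · exact hs P hP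
    · obtain ⟨rs', hlen', hrs', hreg⟩ := hs' ξ fun P hP => hξ P (Finset.mem_union_right _ hP)
      refine ⟨a :: rs', by simp [hlen'], ?_, ?_⟩
      · intro x hx
        rcases List.mem_cons.1 hx with rfl | hx
        · exact hrs x (by simp)
        · exact hrs' x hx
      · exact isWeaklyRegular_swap_head ((isWeaklyRegular_cons_iff _ _ _).2 ⟨ha, hreg⟩)
          (isSMulRegular_of_forall_notMem fun P hP =>
            hξ P (Finset.mem_union_left _ (by simpa using hP)))

theorem _root_.IsSMulRegular.eq_zero_of_mul_eq_zero {a b : A} (ha : IsSMulRegular A a)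
    (h : a * b = 0) : b = 0 :=
  ha.right_eq_zero_of_smul h

/-- The case `M = A` of `exists_finset_forall_notMem`, with the conclusion split into its head and
its tail. -/
theorem exists_finset_forall_notMem_self [IsNoetherianRing A] (𝔞 : Ideal A) (g : ℕ) (rs : List A)
    (hlen : rs.length = g + 1) (hrs : ∀ x ∈ rs, x ∈ 𝔞) (h : IsWeaklyRegular A rs) :
    ∃ s : Finset (Ideal A), (∀ P ∈ s, P.IsPrime ∧ ¬ 𝔞 ≤ P) ∧ ∀ ξ, (∀ P ∈ s, ξ ∉ P) →
      IsSMulRegular A ξ ∧ ∃ rs' : List A, rs'.length = g ∧ (∀ x ∈ rs', x ∈ 𝔞) ∧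
        IsWeaklyRegular (QuotSMulTop ξ A) rs' := by
  obtain ⟨s, hs, hs'⟩ := exists_finset_forall_notMem 𝔞 g rs A hlen hrs h
  refine ⟨s, hs, fun ξ hξ => ?_⟩
  obtain ⟨rs', h1, h2, h3⟩ := hs' ξ hξ
  rw [isWeaklyRegular_cons_iff] at h3
  exact ⟨h3.1, rs', h1, h2, h3.2⟩

/-- The tail of a weakly regular sequence stays weakly regular in a ring isomorphic to the quotient
by its head. -/
theorem IsWeaklyRegular.map_of_ker_eq {B : Type*} [CommRing B] (φ : A →+* B)
    (hφ : Function.Surjective φ) {ξ : A} (hker : RingHom.ker φ = Ideal.span {ξ}) {rs : List A}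
    (h : IsWeaklyRegular (QuotSMulTop ξ A) rs) : IsWeaklyRegular B (rs.map φ) := by
  algebraize [φ]
  have hk : ξ • (⊤ : Submodule A A) = LinearMap.ker (Algebra.linearMap A B) := by
    rw [← ideal_span_singleton_smul, smul_eq_mul, Ideal.mul_top, ← hker]
    rfl
  refine (isWeaklyRegular_map_algebraMap_iff (R := A) B B rs).2 ?_
  exact (LinearEquiv.isWeaklyRegular_congr ((quotEquivOfEq _ _ hk).trans
    ((Algebra.linearMap A B).quotKerEquivOfSurjective hφ)) rs).1 h

/-- The case of `IsWeaklyRegular.map_of_ker_eq` where both rings are quotients, stated apart so that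
it can be applied to associated graded rings without unfolding their ring structure. -/
theorem IsWeaklyRegular.map_of_ker_eq_quotient {A B : Type*} [CommRing A] [CommRing B]
    {𝔞 : Ideal A} {𝔟 : Ideal B} (φ : A ⧸ 𝔞 →+* B ⧸ 𝔟) (hφ : Function.Surjective φ) {ξ : A ⧸ 𝔞}
    (hker : RingHom.ker φ = Ideal.span {ξ}) {rs : List (A ⧸ 𝔞)}
    (h : IsWeaklyRegular (QuotSMulTop ξ (A ⧸ 𝔞)) rs) : IsWeaklyRegular (B ⧸ 𝔟) (rs.map φ) :=
  IsWeaklyRegular.map_of_ker_eq (A := A ⧸ 𝔞) (B := B ⧸ 𝔟) φ hφ hker h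

end RegularSequences

/-! ### Homogeneous components of Rees algebra quotients -/

section GradedPieces

variable {R : Type*} [CommRing R]

/-- The inclusion of the degree `n` component `Jⁿ tⁿ` in the Rees algebra. -/
noncomputable def reesMonomial (J : Ideal R) (n : ℕ) : ↥(J ^ n) →ₗ[R] reesAlgebra J where
  toFun a := ⟨monomial n (a : R), reesAlgebra.monomial_mem.2 a.2⟩
  map_add' a b := Subtype.ext (by simp)
  map_smul' r a := Subtype.ext (by simp [smul_monomial])

/-- The map `Jⁿ → ⨁ᵢ Jⁱ / K Jⁱ` onto the component of degree `n`. -/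
noncomputable def form (K J : Ideal R) (n : ℕ) : ↥(J ^ n) →ₗ[R] reesAlgebra J ⧸ reesIdeal K J :=
  (Ideal.Quotient.mkₐ R (reesIdeal K J)).toLinearMap ∘ₗ reesMonomial J n

variable {K J : Ideal R}

theorem form_apply {n : ℕ} (a : ↥(J ^ n)) :
    form K J n a = Ideal.Quotient.mk (reesIdeal K J) (reesMonomial J n a) := rfl

theorem mem_reesIdeal {f : reesAlgebra J} :
    f ∈ reesIdeal K J ↔ ∀ n, (f : R[X]).coeff n ∈ K * J ^ n := Iff.rfl

theorem reesMonomial_mem_reesIdeal {n : ℕ} {a : ↥(J ^ n)} :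
    reesMonomial J n a ∈ reesIdeal K J ↔ (a : R) ∈ K * J ^ n := by
  rw [mem_reesIdeal]
  refine ⟨fun h => by simpa [reesMonomial] using h n, fun h m => ?_⟩
  change (monomial n (a : R)).coeff m ∈ _
  rw [coeff_monomial]
  split_ifs with hm
  · exact hm ▸ h
  · exact zero_mem _

theorem form_eq_zero_iff {n : ℕ} {a : ↥(J ^ n)} : form K J n a = 0 ↔ (a : R) ∈ K * J ^ n := by
  rw [form_apply, Ideal.Quotient.eq_zero_iff_mem, reesMonomial_mem_reesIdeal]

theorem form_mul {n m : ℕ} (a : ↥(J ^ n)) (b : ↥(J ^ m)) :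
    form K J n a * form K J m b =
      form K J (n + m) ⟨a * b, pow_add J n m ▸ Ideal.mul_mem_mul a.2 b.2⟩ := by
  rw [form_apply, form_apply, form_apply, ← map_mul]
  congr 1
  exact Subtype.ext (monomial_mul_monomial n m _ _)

theorem form_mul_eq {n m k : ℕ} (hk : n + m = k) (a : ↥(J ^ n)) (b : ↥(J ^ m)) (c : ↥(J ^ k))
    (hc : (c : R) = a * b) : form K J n a * form K J m b = form K J k c := by
  subst hk
  rw [form_mul]
  congr 1
  exact Subtype.ext hc.symm

theorem eq_sum_reesMonomial (f : reesAlgebra J) :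
    f = ∑ n ∈ (f : R[X]).support, reesMonomial J n ⟨(f : R[X]).coeff n, f.2 n⟩ := by
  apply Subtype.ext
  rw [AddSubmonoidClass.coe_finsetSum]
  exact (f : R[X]).as_sum_support

/-- The grading of `⨁ₙ Jⁿ / K Jⁿ`. -/
noncomputable def gradedPiece (K J : Ideal R) (n : ℕ) :
    Submodule R (reesAlgebra J ⧸ reesIdeal K J) :=
  LinearMap.range (form K J n)

theorem form_mem_gradedPiece {n : ℕ} (a : ↥(J ^ n)) : form K J n a ∈ gradedPiece K J n :=
  ⟨a, rfl⟩

theorem mul_mem_gradedPiece {n m : ℕ} {y z : reesAlgebra J ⧸ reesIdeal K J}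
    (hy : y ∈ gradedPiece K J n) (hz : z ∈ gradedPiece K J m) :
    y * z ∈ gradedPiece K J (n + m) := by
  obtain ⟨a, rfl⟩ := hy
  obtain ⟨b, rfl⟩ := hz
  rw [form_mul]
  exact form_mem_gradedPiece _

/-- `G(J)₊` is generated by the homogeneous elements of positive degree. -/
theorem assocGradedPlus_le {P : Ideal (AssocGraded J)}
    (h : ∀ n, 1 ≤ n → ∀ z ∈ gradedPiece J J n, z ∈ P) : assocGradedPlus J ≤ P := by
  refine Ideal.map_le_iff_le_comap.2 fun f hf => ?_
  have hf0 : (f : R[X]).coeff 0 = 0 := hf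
  rw [eq_sum_reesMonomial f]
  refine Ideal.sum_mem _ fun n _ => ?_
  rw [Ideal.mem_comap, ← form_apply]
  rcases n with _ | n
  · have : (⟨(f : R[X]).coeff 0, f.2 0⟩ : ↥(J ^ 0)) = 0 := Subtype.ext hf0
    rw [this, map_zero]
    exact zero_mem _
  · exact h (n + 1) (by omega) _ (form_mem_gradedPiece _)

end GradedPieces

/-! ### Change of the base ring in the associated graded ring -/

section QuotientByForm

variable {R : Type*} [CommRing R] (J K : Ideal R)

/-- The map of Rees algebras induced by `R → R / K`. -/
noncomputable def reesMap :
    reesAlgebra J →+* reesAlgebra (J.map (Ideal.Quotient.mk K)) :=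
  ((Polynomial.mapRingHom (Ideal.Quotient.mk K)).comp (reesAlgebra J).val.toRingHom).codRestrict
    (reesAlgebra (J.map (Ideal.Quotient.mk K))) fun f n => by
      change ((f : R[X]).map _).coeff n ∈ _
      rw [coeff_map, ← Ideal.map_pow]
      exact Ideal.mem_map_of_mem _ (f.2 n)

theorem coeff_reesMap (f : reesAlgebra J) (n : ℕ) :
    (reesMap J K f : (R ⧸ K)[X]).coeff n = Ideal.Quotient.mk K ((f : R[X]).coeff n) :=
  coeff_map _ _

theorem reesMap_surjective : Function.Surjective (reesMap J K) := by
  intro f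
  have h : ∀ n, ∃ a : ↥(J ^ n), Ideal.Quotient.mk K a = (f : (R ⧸ K)[X]).coeff n := by
    intro n
    have := f.2 n
    rw [← Ideal.map_pow] at this
    obtain ⟨a, ha, h⟩ := (Ideal.mem_map_iff_of_surjective _ Ideal.Quotient.mk_surjective).1 this
    exact ⟨⟨a, ha⟩, h⟩
  choose a ha using h
  refine ⟨∑ n ∈ (f : (R ⧸ K)[X]).support, reesMonomial J n (a n), ?_⟩
  conv_rhs => rw [eq_sum_reesMonomial f]
  rw [map_sum]
  refine Finset.sum_congr rfl fun n _ => Subtype.ext ?_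
  refine (map_monomial (Ideal.Quotient.mk K)).trans ?_
  rw [ha n]
  rfl

/-- The map `G(J) → G(J (R / K))` induced by `R → R / K`. -/
noncomputable def assocGradedMap :
    AssocGraded J →+* AssocGraded (J.map (Ideal.Quotient.mk K)) :=
  Ideal.quotientMap _ (reesMap J K) fun f hf n => by
    rw [coeff_reesMap, ← pow_succ', ← Ideal.map_pow, pow_succ']
    exact Ideal.mem_map_of_mem _ (hf n)

theorem assocGradedMap_mk (f : reesAlgebra J) :
    assocGradedMap J K (Ideal.Quotient.mk _ f) = Ideal.Quotient.mk _ (reesMap J K f) := rfl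

theorem assocGradedMap_surjective : Function.Surjective (assocGradedMap J K) :=
  Ideal.quotientMap_surjective (reesMap_surjective J K)

theorem assocGradedMap_mem_plus {y : AssocGraded J} (hy : y ∈ assocGradedPlus J) :
    assocGradedMap J K y ∈ assocGradedPlus (J.map (Ideal.Quotient.mk K)) := by
  suffices assocGradedPlus J ≤ (assocGradedPlus (J.map (Ideal.Quotient.mk K))).comap
    (assocGradedMap J K) from this hy
  refine Ideal.map_le_iff_le_comap.2 fun f hf => ?_
  rw [Ideal.mem_comap, Ideal.mem_comap, assocGradedMap_mk]
  refine Ideal.mem_map_of_mem _ ?_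
  have hf0 : (f : R[X]).coeff 0 = 0 := hf
  change (reesMap J K f : (R ⧸ K)[X]).coeff 0 = 0
  rw [coeff_reesMap, hf0, map_zero]

end QuotientByForm

/-! ### The lower bound by the grade -/

section GradeLowerBound

open RingTheory.Sequence

variable {R : Type*} [CommRing R] {I J : Ideal R}

/-- If the class of `x ∈ Jᵉ` in `G(J)` is regular, then `Jⁿ⁺ᵉ : x = Jⁿ`. -/
theorem mem_pow_of_form_regular {e : ℕ} (x : ↥(J ^ e))
    (hreg : IsSMulRegular (AssocGraded J) (form J J e x)) (n : ℕ) (r : R)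
    (h : (x : R) * r ∈ J ^ (n + e)) : r ∈ J ^ n := by
  induction n with
  | zero => simp
  | succ n ih =>
    have hr : r ∈ J ^ n := ih (Ideal.pow_le_pow_right (by omega) h)
    have h0 : form J J e x * form J J n ⟨r, hr⟩ = 0 := by
      rw [form_mul, form_eq_zero_iff, ← pow_succ']
      convert h using 2
      omega
    have h1 := IsSMulRegular.eq_zero_of_mul_eq_zero (A := AssocGraded J) hreg h0
    rw [form_eq_zero_iff, ← pow_succ'] at h1
    exact h1

/-- If the class of `x ∈ Jᵉ` in `G(J)` is regular, then `G(J / x) = G(J) / x`. -/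
theorem ker_assocGradedMap {e : ℕ} (x : ↥(J ^ e))
    (hreg : ∀ n r, (x : R) * r ∈ J ^ (n + e) → r ∈ J ^ n) :
    RingHom.ker (assocGradedMap J (Ideal.span {(x : R)})) = Ideal.span {form J J e x} := by
  apply le_antisymm
  · intro y hy
    obtain ⟨f, rfl⟩ := Ideal.Quotient.mk_surjective y
    rw [RingHom.mem_ker, assocGradedMap_mk, Ideal.Quotient.eq_zero_iff_mem, mem_reesIdeal] at hy
    rw [eq_sum_reesMonomial f, map_sum]
    refine Ideal.sum_mem _ fun n _ => ?_
    rw [← form_apply]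
    have hn := hy n
    rw [coeff_reesMap, ← pow_succ', ← Ideal.map_pow] at hn
    obtain ⟨b, hb, hbf⟩ :=
      (Ideal.mem_map_iff_of_surjective _ Ideal.Quotient.mk_surjective).1 hn
    rw [eq_comm, Ideal.Quotient.mk_eq_mk_iff_sub_mem, Ideal.mem_span_singleton'] at hbf
    obtain ⟨s, hs⟩ := hbf
    have hbn : b ∈ J ^ n := Ideal.pow_le_pow_right n.le_succ hb
    have hsn : s * x ∈ J ^ n := hs ▸ sub_mem (f.2 n) hbn
    have hsplit : form J J n ⟨(f : R[X]).coeff n, f.2 n⟩ = form J J n ⟨s * x, hsn⟩ := by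
      rw [← sub_eq_zero, ← map_sub, form_eq_zero_iff, ← pow_succ']
      change (f : R[X]).coeff n - s * x ∈ _
      rw [hs, sub_sub_cancel]
      exact hb
    rw [hsplit]
    -- below degree `e`, the multiple `s x ∈ Jᵉ ⊆ Jⁿ⁺¹` has zero form in degree `n`
    rcases lt_or_ge n e with hne | hne
    · have : form J J n ⟨s * x, hsn⟩ = 0 := by
        rw [form_eq_zero_iff, ← pow_succ']
        exact Ideal.mul_mem_left _ _ (Ideal.pow_le_pow_right hne x.2)
      rw [this]
      exact zero_mem _
    · obtain ⟨m, rfl⟩ := Nat.exists_eq_add_of_le' hne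
      have hsm : s ∈ J ^ m := hreg m s (by rwa [mul_comm])
      rw [← form_mul_eq rfl ⟨s, hsm⟩ x ⟨s * x, hsn⟩ rfl]
      exact Ideal.mul_mem_left _ _ (Ideal.mem_span_singleton_self _)
  · rw [Ideal.span_singleton_le_iff_mem, RingHom.mem_ker, form_apply, assocGradedMap_mk,
      Ideal.Quotient.eq_zero_iff_mem]
    intro n
    rw [coeff_reesMap]
    change Ideal.Quotient.mk _ ((monomial e (x : R)).coeff n) ∈ _
    rw [coeff_monomial]
    split_ifs
    · rw [Ideal.Quotient.eq_zero_iff_mem.2 (Ideal.mem_span_singleton_self _)]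
      exact zero_mem _
    · rw [map_zero]
      exact zero_mem _

/-- A weakly regular sequence of length `g` in `G(J)₊` forces `λ(Iⁿ / Jⁿ)` to grow at least as the
number of monomials of degree `n` in `g` variables. -/
theorem exists_multichoose_le_of_isWeaklyRegular [IsNoetherianRing R] (hJI : J < I) (g : ℕ)
    (rs : List (AssocGraded J)) (hlen : rs.length = g) (hrs : ∀ y ∈ rs, y ∈ assocGradedPlus J)
    (hreg : IsWeaklyRegular (AssocGraded J) rs) :
    ∃ D, 1 ≤ D ∧ ∀ k, (g.multichoose k : ℕ∞) ≤ powQuotLength I J (1 + D * k) := by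
  induction g generalizing R with
  | zero =>
    -- only `k = 0` requires something, and there `J ≠ I` is used
    refine ⟨1, le_rfl, fun k => ?_⟩
    rcases k with _ | k
    · simpa using one_le_powQuotLength_one hJI
    · simp [Nat.multichoose_zero_succ]
  | succ g ih =>
    obtain ⟨s, hs, hs'⟩ := exists_finset_forall_notMem_self (A := AssocGraded J)
      (assocGradedPlus J) g rs hlen hrs hreg
    have hmiss : ∀ P ∈ s, P.IsPrime ∧ ∃ e, 1 ≤ e ∧ ∃ z ∈ gradedPiece J J e, z ∉ P := by
      intro P hP
      refine ⟨(hs P hP).1, ?_⟩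
      by_contra! h
      exact (hs P hP).2 (assocGradedPlus_le h)
    obtain ⟨e, he, _, ⟨x, rfl⟩, hxs⟩ :=
      exists_homogeneous_notMem (fun n => (gradedPiece J J n : Set (AssocGraded J)))
        (fun n y hy z hz => (gradedPiece J J n).add_mem hy hz)
        (fun n m y hy z hz => mul_mem_gradedPiece hy hz) s hmiss (zero_mem _)
    obtain ⟨hxreg, rs', hlen', hrs', hreg'⟩ := hs' _ hxs
    have hx := mem_pow_of_form_regular x hxreg
    have hxJ : Ideal.span {(x : R)} ≤ J := (Ideal.span_singleton_le_iff_mem _).2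
      (Ideal.pow_le_self (by omega) x.2)
    refine exists_multichoose_succ_le hJI he x.2 hx ?_
    have hmap := IsWeaklyRegular.map_of_ker_eq_quotient (assocGradedMap J (Ideal.span {(x : R)}))
      (assocGradedMap_surjective J (Ideal.span {(x : R)})) (ker_assocGradedMap x hx) hreg'
    refine ih (map_mk_lt_map_mk hJI hxJ) (rs'.map (assocGradedMap J (Ideal.span {(x : R)})))
      (by simpa using hlen') ?_ hmap
    intro y hy
    obtain ⟨z, hz, rfl⟩ := List.mem_map.1 hy
    exact assocGradedMap_mem_plus _ _ (hrs' z hz)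

end GradeLowerBound

/-! ### Powers of ideals generated by regular sequences -/

section CompleteIntersection

open RingTheory.Sequence Submodule Pointwise

variable {R : Type*} [CommRing R]

theorem sup_pow_succ_le (X L : Ideal R) (n : ℕ) :
    (X ⊔ L) ^ (n + 1) ≤ X * (X ⊔ L) ^ n ⊔ L ^ (n + 1) := by
  induction n with
  | zero => simp
  | succ n ih =>
    rw [pow_succ', Ideal.sup_mul, pow_succ' L]
    refine sup_le le_sup_left ((Ideal.mul_mono_right ih).trans ?_)
    rw [Ideal.mul_sup]
    refine sup_le (le_sup_of_le_left ?_) le_sup_right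
    rw [mul_left_comm, pow_succ' (X ⊔ L)]
    exact Ideal.mul_mono_right (Ideal.mul_mono_left le_sup_right)

/-- Cancellation of `x` in powers of `(x) + L`, given cancellation in powers of `L`. -/
theorem mem_sup_pow_smul_of_smul_mem {M : Type*} [AddCommGroup M] [Module R M] {x : R} {L : Ideal R}
    (h : ∀ n (m : M), x • m ∈ L ^ n • (⊤ : Submodule R M) → m ∈ L ^ n • (⊤ : Submodule R M))
    (n : ℕ) (m : M) (hm : x • m ∈ (Ideal.span {x} ⊔ L) ^ (n + 1) • (⊤ : Submodule R M)) :
    m ∈ (Ideal.span {x} ⊔ L) ^ n • (⊤ : Submodule R M) := by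
  have h1 := Submodule.smul_mono_left (sup_pow_succ_le (Ideal.span {x}) L n) hm
  rw [Submodule.sup_smul, mul_smul, ideal_span_singleton_smul] at h1
  obtain ⟨_, ha, l, hl, hal⟩ := Submodule.mem_sup.1 h1
  obtain ⟨a, ha', rfl⟩ := (mem_smul_pointwise_iff_exists _ _ _).1 ha
  have h2 : m - a ∈ L ^ (n + 1) • (⊤ : Submodule R M) := by
    refine h _ _ ?_
    rw [smul_sub, ← hal, add_sub_cancel_left]
    exact hl
  have h3 : L ^ (n + 1) ≤ (Ideal.span {x} ⊔ L) ^ n :=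
    (Ideal.pow_le_pow_right n.le_succ).trans (Ideal.pow_right_mono le_sup_right n)
  have h4 := add_mem (Submodule.smul_mono_left h3 h2) ha'
  rwa [sub_add_cancel] at h4

/-- If `rs, y` is a regular sequence on `M`, then `y` is a nonzerodivisor modulo all powers of the
ideal generated by `rs`. -/
theorem mem_ofList_pow_smul_of_smul_mem [IsLocalRing R] [IsNoetherianRing R] (rs : List R) (y : R)
    (M : Type*) [AddCommGroup M] [Module R M] [Module.Finite R M]
    (hrs : ∀ x ∈ rs ++ [y], x ∈ IsLocalRing.maximalIdeal R) (h : IsWeaklyRegular M (rs ++ [y]))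
    (n : ℕ) (m : M) (hm : y • m ∈ Ideal.ofList rs ^ n • (⊤ : Submodule R M)) :
    m ∈ Ideal.ofList rs ^ n • (⊤ : Submodule R M) := by
  induction rs generalizing y M n m with
  | nil =>
    rcases n with _ | n
    · simp
    · rw [Ideal.ofList_nil, Ideal.bot_pow (by omega), Submodule.bot_smul, Submodule.mem_bot] at hm ⊢
      exact ((isWeaklyRegular_singleton_iff _ _).1 h).right_eq_zero_of_smul hm
  | cons x L ih =>
    have hx : IsWeaklyRegular M (L ++ [x]) := by
      have hperm : List.Perm (x :: L ++ [y]) ((L ++ [x]) ++ [y]) :=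
        (List.perm_append_singleton x L).symm.append_right [y]
      exact ((isWeaklyRegular_append_iff _ _ _).1
        (IsLocalRing.isWeaklyRegular_of_perm_of_subset_maximalIdeal h hperm hrs)).1
    have hcancel := mem_sup_pow_smul_of_smul_mem
      (ih x M (fun z hz => hrs z (by simp at hz ⊢; tauto)) hx)
    rw [Ideal.ofList_cons] at hm ⊢
    induction n generalizing m with
    | zero => simp
    | succ n ihn =>
      -- modulo `x`, the hypothesis for the shorter sequence shows that `m` lies in `Lⁿ⁺¹ M + x M`
      have hq : mkQ (x • (⊤ : Submodule R M)) m ∈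
          Ideal.ofList L ^ (n + 1) • (⊤ : Submodule R (QuotSMulTop x M)) := by
        refine ih y (QuotSMulTop x M) (fun z hz => hrs z (by simp at hz ⊢; tauto))
          ((isWeaklyRegular_cons_iff _ _ _).1 h).2 (n + 1) _ ?_
        have h1 := Submodule.smul_mono_left (sup_pow_succ_le (Ideal.span {x}) (Ideal.ofList L) n) hm
        rw [Submodule.sup_smul, mul_smul, ideal_span_singleton_smul] at h1
        obtain ⟨_, ha, l, hl, hal⟩ := Submodule.mem_sup.1 h1
        obtain ⟨a, -, rfl⟩ := (mem_smul_pointwise_iff_exists _ _ _).1 ha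
        rw [← map_smul, ← hal, map_add]
        have h0 : mkQ (x • (⊤ : Submodule R M)) (x • a) = 0 :=
          (Submodule.Quotient.mk_eq_zero _).2 (smul_mem_pointwise_smul _ _ _ mem_top)
        rw [h0, zero_add, ← Submodule.range_mkQ (x • (⊤ : Submodule R M)), ← Submodule.map_top,
          ← Submodule.map_smul'']
        exact Submodule.mem_map_of_mem hl
      rw [← Submodule.range_mkQ (x • (⊤ : Submodule R M)), ← Submodule.map_top,
        ← Submodule.map_smul''] at hq
      obtain ⟨a, ha, ham⟩ := hq
      have hs : m - a ∈ x • (⊤ : Submodule R M) := (Submodule.Quotient.eq _).1 ham.symm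
      obtain ⟨s, -, hs⟩ := (mem_smul_pointwise_iff_exists _ _ _).1 hs
      have haJ : a ∈ (Ideal.span {x} ⊔ Ideal.ofList L) ^ (n + 1) • (⊤ : Submodule R M) :=
        Submodule.smul_mono_left (Ideal.pow_right_mono le_sup_right _) ha
      have hys : x • y • s ∈ (Ideal.span {x} ⊔ Ideal.ofList L) ^ (n + 1) • (⊤ : Submodule R M) := by
        rw [smul_comm, hs, smul_sub]
        exact sub_mem hm (Submodule.smul_mem _ y haJ)
      -- writing `m = a + x s`, cancel `x` in `x y s`, then `y` in `y s` by induction on `n`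
      have hsJ := ihn s (hcancel n _ hys)
      have hxs : x • s ∈ (Ideal.span {x} ⊔ Ideal.ofList L) ^ (n + 1) • (⊤ : Submodule R M) := by
        rw [pow_succ', mul_smul]
        exact Submodule.smul_mem_smul (Ideal.mem_sup_left (Ideal.mem_span_singleton_self x)) hsJ
      rw [hs] at hxs
      simpa using add_mem hxs haJ

/-- The lower bound on `λ(Iⁿ / Jⁿ)` for an ideal `J` generated by a regular sequence. -/
theorem exists_multichoose_le_of_ofList [IsLocalRing R] [IsNoetherianRing R] {I : Ideal R}
    (rs : List R) (hrs : ∀ x ∈ rs, x ∈ IsLocalRing.maximalIdeal R) (h : IsWeaklyRegular R rs)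
    (hJI : Ideal.ofList rs < I) :
    ∃ D, 1 ≤ D ∧ ∀ k, (rs.length.multichoose k : ℕ∞) ≤
      powQuotLength I (Ideal.ofList rs) (1 + D * k) := by
  generalize hg : rs.length = g
  induction g generalizing R with
  | zero =>
    refine ⟨1, le_rfl, fun k => ?_⟩
    rcases k with _ | k
    · simpa using one_le_powQuotLength_one hJI
    · simp [Nat.multichoose_zero_succ]
  | succ g ih =>
    obtain ⟨x, L, rfl⟩ := List.exists_cons_of_length_eq_add_one hg
    have hxm : x ∈ IsLocalRing.maximalIdeal R := hrs x (by simp)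
    have hx : IsWeaklyRegular R (L ++ [x]) :=
      IsLocalRing.isWeaklyRegular_of_perm_of_subset_maximalIdeal h
        (List.perm_append_singleton x L).symm hrs
    have hcancel : ∀ n r, x * r ∈ Ideal.ofList (x :: L) ^ (n + 1) →
        r ∈ Ideal.ofList (x :: L) ^ n := by
      intro n r hr
      have := mem_sup_pow_smul_of_smul_mem (mem_ofList_pow_smul_of_smul_mem L x R
        (fun z hz => hrs z (by simp at hz ⊢; tauto)) hx) n r
      rw [smul_eq_mul, smul_eq_mul, smul_eq_mul, Ideal.mul_top, Ideal.mul_top,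
        ← Ideal.ofList_cons] at this
      exact this hr
    have hxJ : Ideal.span {x} ≤ Ideal.ofList (x :: L) := by
      rw [Ideal.ofList_cons]
      exact le_sup_left
    refine exists_multichoose_succ_le hJI le_rfl
      (by simpa using hxJ (Ideal.mem_span_singleton_self x)) hcancel ?_
    have hnt : Nontrivial (R ⧸ Ideal.span {x}) := Ideal.Quotient.nontrivial_iff.2 fun htop =>
      (IsLocalRing.mem_maximalIdeal x).1 hxm (Ideal.span_singleton_eq_top.1 htop)
    have hloc : IsLocalRing (R ⧸ Ideal.span {x}) :=
      IsLocalRing.of_surjective' _ Ideal.Quotient.mk_surjective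
    have hlhom : IsLocalHom (Ideal.Quotient.mk (Ideal.span {x})) :=
      IsLocalHom.of_surjective _ Ideal.Quotient.mk_surjective
    have hmap : (Ideal.ofList (x :: L)).map (Ideal.Quotient.mk (Ideal.span {x})) =
        Ideal.ofList (L.map (Ideal.Quotient.mk (Ideal.span {x}))) := by
      rw [Ideal.map_ofList, List.map_cons, Ideal.ofList_cons,
        Ideal.Quotient.eq_zero_iff_mem.2 (Ideal.mem_span_singleton_self x)]
      simp
    have hlt := map_mk_lt_map_mk hJI hxJ
    rw [hmap] at hlt ⊢
    refine ih _ ?_ ?_ hlt (by simpa using hg)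
    · intro z hz
      obtain ⟨r, hr, rfl⟩ := List.mem_map.1 hz
      rw [IsLocalRing.mem_maximalIdeal]
      exact map_mem_nonunits_iff _ r |>.2
        ((IsLocalRing.mem_maximalIdeal r).1 (hrs r (by simp [hr])))
    · exact IsWeaklyRegular.map_of_ker_eq _ Ideal.Quotient.mk_surjective Ideal.mk_ker
        ((isWeaklyRegular_cons_iff _ _ _).1 h).2

end CompleteIntersection

/-! ### Growth of finitely generated algebras -/

section GrowthOfAlgebras

open MvPolynomial
open scoped Pointwise

/-- By lying over and going up, chains of primes lift along injective integral extensions. -/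
theorem ringKrullDim_le_of_isIntegral {A B : Type*} [CommRing A] [CommRing B] [Algebra A B]
    [FaithfulSMul A B] [Algebra.IsIntegral A B] : ringKrullDim A ≤ ringKrullDim B := by
  refine iSup_le fun l => ?_
  obtain ⟨Q, hQ, hQl⟩ := (Ideal.nonempty_primesOver (S := B) l.head.asIdeal).some
  obtain ⟨L, hL, -⟩ := Ideal.exists_ltSeries_of_hasGoingUp l Q
  exact hL ▸ le_iSup (fun L : LTSeries (PrimeSpectrum B) => (L.length : WithBot ℕ∞)) L

variable {k F : Type*} [Field k] [CommRing F] [Algebra k F] {s : ℕ}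

/-- The image in `F` of the polynomials of total degree at most `d`. -/
noncomputable def degreeLE (g : MvPolynomial (Fin s) k →ₐ[k] F) (d : ℕ) : Submodule k F :=
  (restrictTotalDegree (Fin s) k d).map g.toLinearMap

theorem map_mem_degreeLE (g : MvPolynomial (Fin s) k →ₐ[k] F) (p : MvPolynomial (Fin s) k) :
    g p ∈ degreeLE g p.totalDegree :=
  ⟨p, (mem_restrictTotalDegree _ _ _).2 le_rfl, rfl⟩

theorem one_mem_degreeLE (g : MvPolynomial (Fin s) k →ₐ[k] F) : 1 ∈ degreeLE g 0 := by
  simpa using map_mem_degreeLE g 1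

theorem degreeLE_mono (g : MvPolynomial (Fin s) k →ₐ[k] F) : Monotone (degreeLE g) := by
  intro a b hab
  refine Submodule.map_mono fun p hp => ?_
  rw [mem_restrictTotalDegree] at hp ⊢
  exact hp.trans hab

theorem degreeLE_mul_le (g : MvPolynomial (Fin s) k →ₐ[k] F) (a b : ℕ) :
    degreeLE g a * degreeLE g b ≤ degreeLE g (a + b) := by
  rw [Submodule.mul_le]
  rintro _ ⟨p, hp, rfl⟩ _ ⟨q, hq, rfl⟩
  refine ⟨p * q, ?_, map_mul g p q⟩
  rw [SetLike.mem_coe, mem_restrictTotalDegree] at hp hq ⊢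
  exact (totalDegree_mul p q).trans (add_le_add hp hq)

theorem exists_degreeLE_le_span (g : MvPolynomial (Fin s) k →ₐ[k] F) (d : ℕ) :
    ∃ t : Finset F, t.card ≤ (d + 1) ^ s ∧ degreeLE g d ≤ Submodule.span k (t : Set F) := by
  classical
  refine ⟨Finset.univ.image fun e : Fin s → Fin (d + 1) =>
    g (monomial (Finsupp.equivFunOnFinite.symm fun i => (e i : ℕ)) 1), ?_, ?_⟩
  · refine Finset.card_image_le.trans ?_
    simp
  · rintro _ ⟨p, hp, rfl⟩
    have hp' := (mem_restrictDegree _ _ _).1 (restrictTotalDegree_le_restrictDegree _ _ d hp)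
    change g p ∈ _
    rw [p.as_sum, map_sum]
    refine Submodule.sum_mem _ fun e he => ?_
    have hc : monomial e (coeff e p) = coeff e p • monomial e (1 : k) := by
      rw [MvPolynomial.smul_monomial, smul_eq_mul, mul_one]
    rw [hc, map_smul]
    refine Submodule.smul_mem _ _ (Submodule.subset_span ?_)
    rw [Finset.mem_coe, Finset.mem_image]
    refine ⟨fun i => ⟨e i, Nat.lt_succ_of_le (hp' e he i)⟩, Finset.mem_univ _, ?_⟩
    exact congrArg (fun x => g (monomial x 1)) (Finsupp.ext fun i => rfl)

/-- If `F` is finite over the polynomial ring, with generators `m`, every finite-dimensional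
subspace of `F` consists of combinations of `m` with coefficients of bounded degree. -/
theorem exists_le_degreeLE_mul (g : MvPolynomial (Fin s) k →ₐ[k] F) (hg : g.Finite) :
    ∃ m : Finset F, ∀ U : Submodule k F, U.FG →
      ∃ d, U ≤ degreeLE g d * Submodule.span k (m : Set F) := by
  classical
  algebraize [g.toRingHom]
  obtain ⟨m, hm⟩ := (Module.finite_def (R := MvPolynomial (Fin s) k) (M := F)).1 hg
  set N := Submodule.span k (m : Set F) with hN
  have hmono : ∀ {a b}, a ≤ b → degreeLE g a * N ≤ degreeLE g b * N :=
    fun hab => mul_le_mul' (degreeLE_mono g hab) le_rfl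
  have hex : ∀ f : F, ∃ d, f ∈ degreeLE g d * N := by
    intro f
    have hf : f ∈ Submodule.span (MvPolynomial (Fin s) k) (m : Set F) := hm ▸ Submodule.mem_top
    induction hf using Submodule.span_induction with
    | mem x hx =>
      have hxN : x ∈ N := Submodule.subset_span hx
      exact ⟨0, by simpa using Submodule.mul_mem_mul (one_mem_degreeLE g) hxN⟩
    | zero => exact ⟨0, zero_mem _⟩
    | add x y _ _ hx hy =>
      obtain ⟨a, ha⟩ := hx
      obtain ⟨b, hb⟩ := hy
      exact ⟨max a b, add_mem (hmono (le_max_left a b) ha) (hmono (le_max_right a b) hb)⟩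
    | smul p x _ hx =>
      obtain ⟨a, ha⟩ := hx
      refine ⟨p.totalDegree + a, ?_⟩
      have h1 := Submodule.mul_mem_mul (map_mem_degreeLE g p) ha
      rw [← mul_assoc] at h1
      exact mul_le_mul' (degreeLE_mul_le g _ _) le_rfl h1
  refine ⟨m, fun U hU => ?_⟩
  obtain ⟨t, rfl⟩ := hU
  choose d hd using hex
  exact ⟨t.sup d, Submodule.span_le.2 fun x hx => hmono (Finset.le_sup hx) (hd x)⟩

/-- A finitely generated algebra `F` over a field has growth of order at most `n ^ s` for some
`s ≤ dim F`: by Noether normalization it is finite over a polynomial ring in `s` variables. -/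
theorem exists_finrank_pow_le (k F : Type*) [Field k] [CommRing F] [Nontrivial F] [Algebra k F]
    [Algebra.FiniteType k F] :
    ∃ s : ℕ, ((s : ℕ∞) : WithBot ℕ∞) ≤ ringKrullDim F ∧ ∀ V : Submodule k F, V.FG →
      ∃ c : ℕ, ∀ n : ℕ, Module.finrank k ↥(V ^ n) ≤ c * (n + 1) ^ s := by
  obtain ⟨s, g, hinj, hfin⟩ := exists_finite_inj_algHom_of_fg k F
  refine ⟨s, ?_, fun V hV => ?_⟩
  · have hdim : ringKrullDim (MvPolynomial (Fin s) k) = ((s : ℕ∞) : WithBot ℕ∞) := by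
      rw [MvPolynomial.ringKrullDim_of_isNoetherianRing, ringKrullDim_eq_zero_of_field]
      simp
    rw [← hdim]
    algebraize [g.toRingHom]
    have hfs : FaithfulSMul (MvPolynomial (Fin s) k) F :=
      (faithfulSMul_iff_algebraMap_injective _ _).2 hinj
    have hf : Module.Finite (MvPolynomial (Fin s) k) F := hfin
    exact ringKrullDim_le_of_isIntegral
  · obtain ⟨m, hm⟩ := exists_le_degreeLE_mul g hfin
    set N := Submodule.span k (m : Set F) with hN
    obtain ⟨D, hD⟩ := hm (V * N) (hV.mul ⟨m, rfl⟩)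
    obtain ⟨D₀, hD₀⟩ := hm 1 (by rw [Submodule.one_eq_span]; exact Submodule.fg_span_singleton _)
    have hpow : ∀ n, V ^ n ≤ degreeLE g (D₀ + n * D) * N := by
      intro n
      induction n with
      | zero => simpa using hD₀
      | succ n ih =>
        rw [pow_succ']
        calc V * V ^ n ≤ V * (degreeLE g (D₀ + n * D) * N) := mul_le_mul' le_rfl ih
          _ = degreeLE g (D₀ + n * D) * (V * N) := mul_left_comm _ _ _
          _ ≤ degreeLE g (D₀ + n * D) * (degreeLE g D * N) := mul_le_mul' le_rfl hD
          _ = degreeLE g (D₀ + n * D) * degreeLE g D * N := (mul_assoc _ _ _).symm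
          _ ≤ degreeLE g (D₀ + (n + 1) * D) * N := mul_le_mul'
            ((degreeLE_mul_le g _ _).trans_eq (by congr 1; ring)) le_rfl
    refine ⟨(D₀ + D + 1) ^ s * m.card, fun n => ?_⟩
    classical
    obtain ⟨t, htc, ht⟩ := exists_degreeLE_le_span g (D₀ + n * D)
    have hle : V ^ n ≤ Submodule.span k ((t * m : Finset F) : Set F) := by
      rw [Finset.coe_mul, ← Submodule.span_mul_span]
      exact (hpow n).trans (mul_le_mul' ht le_rfl)
    calc Module.finrank k ↥(V ^ n)
        ≤ Module.finrank k ↥(Submodule.span k ((t * m : Finset F) : Set F)) :=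
          Submodule.finrank_mono hle
      _ ≤ (t * m).card := finrank_span_finset_le_card _
      _ ≤ t.card * m.card := Finset.card_mul_le
      _ ≤ (D₀ + n * D + 1) ^ s * m.card := Nat.mul_le_mul_right _ htc
      _ ≤ ((D₀ + D + 1) * (n + 1)) ^ s * m.card := by
          refine Nat.mul_le_mul_right _ (Nat.pow_le_pow_left ?_ s)
          nlinarith [Nat.zero_le (D₀ * n), Nat.zero_le n, Nat.zero_le D]
      _ = (D₀ + D + 1) ^ s * m.card * (n + 1) ^ s := by rw [mul_pow]; ring

section Local

open IsLocalRing

variable (R F : Type*) [CommRing R] [IsLocalRing R] [CommRing F] [Algebra R F]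

/-- The structure of an algebra over the residue field on an `R`-algebra killed by the maximal
ideal. -/
noncomputable abbrev residueAlgebra (h : ∀ r ∈ maximalIdeal R, algebraMap R F r = 0) :
    Algebra (ResidueField R) F :=
  (Ideal.Quotient.lift (maximalIdeal R) (algebraMap R F) h).toAlgebra

theorem residueAlgebra_isScalarTower (h : ∀ r ∈ maximalIdeal R, algebraMap R F r = 0) :
    letI := residueAlgebra R F h
    IsScalarTower R (ResidueField R) F :=
  letI := residueAlgebra R F h
  IsScalarTower.of_algebraMap_eq fun _ => rfl

/-- The growth of a finitely generated `R`-algebra killed by the maximal ideal. -/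
theorem exists_length_pow_le [Nontrivial F] [Algebra.FiniteType R F]
    (h : ∀ r ∈ maximalIdeal R, algebraMap R F r = 0) :
    ∃ s : ℕ, ((s : ℕ∞) : WithBot ℕ∞) ≤ ringKrullDim F ∧ ∀ V : Submodule R F, V.FG →
      ∃ c : ℕ, ∀ n : ℕ, Module.length R ↥(V ^ n) ≤ (c * (n + 1) ^ s : ℕ) := by
  let := residueAlgebra R F h
  have := residueAlgebra_isScalarTower R F h
  have : Algebra.FiniteType (ResidueField R) F :=
    Algebra.FiniteType.of_restrictScalars_finiteType R _ _
  obtain ⟨s, hs, hV⟩ := exists_finrank_pow_le (ResidueField R) F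
  refine ⟨s, hs, ?_⟩
  rintro _ ⟨t, rfl⟩
  obtain ⟨c, hc⟩ := hV (Submodule.span (ResidueField R) (t : Set F)) ⟨t, rfl⟩
  refine ⟨c, fun n => ?_⟩
  set W := Submodule.span (ResidueField R) (t : Set F) ^ n with hW
  have hWfin : Module.Finite (ResidueField R) W :=
    Module.Finite.iff_fg.2 (Submodule.FG.pow ⟨t, rfl⟩ n)
  have hle : Submodule.span R (t : Set F) ^ n ≤ W.restrictScalars R := by
    rw [hW, Submodule.span_pow, Submodule.span_pow]
    exact Submodule.span_le_restrictScalars R (ResidueField R) _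
  calc Module.length R ↥(Submodule.span R (t : Set F) ^ n)
      ≤ Module.length R ↥(W.restrictScalars R) :=
        Module.length_le_of_injective (Submodule.inclusion hle) (Submodule.inclusion_injective hle)
    _ = Module.length (ResidueField R) ↥(W.restrictScalars R) :=
        Module.length_eq_of_surjective residue_surjective
    _ = Module.length (ResidueField R) W :=
        (Submodule.restrictScalarsEquiv R (ResidueField R) F W).length_eq
    _ = (Module.finrank (ResidueField R) W : ℕ∞) := Module.length_eq_finrank _ _
    _ ≤ _ := by exact_mod_cast hc n

/-- An `R`-algebra killed by the maximal ideal is a quotient of a polynomial ring over the residue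
field in as many variables as it has generators. -/
theorem ringKrullDim_le_of_adjoin_eq_top {d : ℕ} (f : Fin d → F)
    (hf : Algebra.adjoin R (Set.range f) = ⊤)
    (h : ∀ r ∈ maximalIdeal R, algebraMap R F r = 0) :
    ringKrullDim F ≤ ((d : ℕ∞) : WithBot ℕ∞) := by
  let := residueAlgebra R F h
  have := residueAlgebra_isScalarTower R F h
  have htop : Algebra.adjoin (ResidueField R) (Set.range f) = ⊤ := by
    rw [eq_top_iff]
    intro x _
    have hx : x ∈ Algebra.adjoin R (Set.range f) := hf ▸ Algebra.mem_top
    have hle : Algebra.adjoin R (Set.range f) ≤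
        (Algebra.adjoin (ResidueField R) (Set.range f)).restrictScalars R :=
      Algebra.adjoin_le Algebra.subset_adjoin
    exact hle hx
  have hsurj : Function.Surjective (MvPolynomial.aeval (R := ResidueField R) f) := by
    rw [← AlgHom.range_eq_top, ← Algebra.adjoin_range_eq_range_aeval, htop]
  refine (ringKrullDim_le_of_surjective
    (MvPolynomial.aeval (R := ResidueField R) f).toRingHom hsurj).trans_eq ?_
  rw [MvPolynomial.ringKrullDim_of_isNoetherianRing, ringKrullDim_eq_zero_of_field]
  simp

end Local

end GrowthOfAlgebras

/-! ### Comparison with the powers of the maximal ideal -/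

section LengthBounds

variable {R : Type*} [CommRing R]

theorem relLength_sup_le {A B A' B' : Ideal R} (hA : A' ≤ A) (hB : B' ≤ B) :
    relLength (A ⊔ B) (A' ⊔ B') ≤ relLength A A' + relLength B B' := by
  rw [relLength_add (B := A ⊔ B') (sup_le_sup_right hA B') (sup_le_sup_left hB A), add_comm]
  refine add_le_add ?_ ?_
  · refine relLength_le_of_map LinearMap.id (fun a ha => Submodule.mem_sup_left ha)
      (fun a _ ha => Submodule.mem_sup_left ha) fun c hc => ?_
    obtain ⟨a, ha, b, hb, rfl⟩ := Submodule.mem_sup.1 hc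
    exact ⟨a, ha, by simpa using Submodule.mem_sup_right hb⟩
  · refine relLength_le_of_map LinearMap.id (fun a ha => Submodule.mem_sup_right ha)
      (fun a _ ha => Submodule.mem_sup_right ha) fun c hc => ?_
    obtain ⟨a, ha, b, hb, rfl⟩ := Submodule.mem_sup.1 hc
    exact ⟨b, hb, by simpa using Submodule.mem_sup_left ha⟩

/-- If `B` has `c` generators, then `X B / Y X B` is a quotient of `(X / Y X)ᶜ`. -/
theorem relLength_mul_le (X Y B : Ideal R) (S : Finset R) (hS : Ideal.span (S : Set R) = B) :
    relLength (X * B) (Y * (X * B)) ≤ S.card * relLength X (Y * X) := by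
  classical
  induction S using Finset.induction_on generalizing B with
  | empty =>
    subst hS
    simp [relLength_eq_zero_of_le]
  | insert x S hx ih =>
    rw [Finset.coe_insert, Ideal.span_insert] at hS
    subst hS
    rw [Finset.card_insert_of_notMem hx, Nat.cast_add, Nat.cast_one, add_mul, one_mul, add_comm,
      Ideal.mul_sup, Ideal.mul_sup]
    refine (relLength_sup_le Ideal.mul_le_right Ideal.mul_le_right).trans
      (add_le_add ?_ (ih _ rfl))
    refine relLength_le_of_map (LinearMap.lsmul R R x) (fun a ha => ?_) (fun a _ ha => ?_) ?_
    · rw [LinearMap.lsmul_apply, smul_eq_mul, mul_comm x a]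
      exact Ideal.mul_mem_mul ha (Ideal.mem_span_singleton_self x)
    · rw [LinearMap.lsmul_apply, smul_eq_mul, mul_comm x a, ← mul_assoc]
      exact Ideal.mul_mem_mul ha (Ideal.mem_span_singleton_self x)
    · intro y hy
      rw [mul_comm, Ideal.mem_span_singleton_mul] at hy
      obtain ⟨a, ha, rfl⟩ := hy
      exact ⟨a, ha, by simp⟩

/-- `X / 𝔪ᴷ X` has length at most a constant, independent of `X`, times that of `X / 𝔪 X`. -/
theorem exists_relLength_pow_mul_le [IsNoetherianRing R] (m : Ideal R) (K : ℕ) :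
    ∃ c : ℕ, ∀ X : Ideal R, relLength X (m ^ K * X) ≤ c * relLength X (m * X) := by
  induction K with
  | zero => exact ⟨0, fun X => by simp [relLength_eq_zero_of_le]⟩
  | succ K ih =>
    obtain ⟨c, hc⟩ := ih
    obtain ⟨S, hS⟩ := IsNoetherian.noetherian (m ^ K)
    refine ⟨c + S.card, fun X => ?_⟩
    have h1 : m ^ (K + 1) * X ≤ m ^ K * X := Ideal.mul_mono_left (Ideal.pow_le_pow_right K.le_succ)
    rw [relLength_add h1 Ideal.mul_le_right, Nat.cast_add, add_mul]
    refine add_le_add (hc X) ?_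
    have := relLength_mul_le X m (m ^ K) S hS
    rwa [mul_comm X, ← mul_assoc, ← pow_succ'] at this

variable {I J : Ideal R}

/-- If `𝔪ᴷ Iⁿ ⊆ Jⁿ` for large `n`, then `λ(Iⁿ / Jⁿ)` is bounded by a multiple of the Hilbert
function of the fiber cone of `J`, up to a shift. -/
theorem exists_powQuotLength_add_le [IsNoetherianRing R] (m : Ideal R) {K N : ℕ}
    (hI : ∀ j, I ^ (N + j) = J ^ j * I ^ N) (hK : ∀ j, m ^ K * I ^ (N + j) ≤ J ^ (N + j)) :
    ∃ c : ℕ, ∀ j, powQuotLength I J (N + j) ≤ c * relLength (J ^ j) (m * J ^ j) := by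
  obtain ⟨c, hc⟩ := exists_relLength_pow_mul_le m K
  obtain ⟨S, hS⟩ := IsNoetherian.noetherian (I ^ N)
  refine ⟨S.card * c, fun j => ?_⟩
  rw [powQuotLength_eq_relLength]
  refine (relLength_anti (hK j)).trans ?_
  rw [hI j]
  refine (relLength_mul_le (J ^ j) (m ^ K) (I ^ N) S hS).trans ?_
  rw [Nat.cast_mul, mul_assoc]
  gcongr
  exact hc _

/-- If some `Iʳ / Jʳ` with `r ≥ 1` has finite length and `J` is a reduction of `I`, then a fixed
power of `𝔪` annihilates `Iⁿ / Jⁿ` for all large `n`. -/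
theorem IsReduction.exists_pow_mul_le [IsNoetherianRing R] [IsLocalRing R] (h : IsReduction J I)
    {r : ℕ} (hr : 0 < r) (hfin : powQuotLength I J r < ⊤) :
    ∃ K N, (∀ j, I ^ (N + j) = J ^ j * I ^ N) ∧
      ∀ j, IsLocalRing.maximalIdeal R ^ K * I ^ (N + j) ≤ J ^ (N + j) := by
  set m := IsLocalRing.maximalIdeal R
  set Q := ↥(I ^ r) ⧸ Submodule.submoduleOf (J ^ r) (I ^ r) with hQ
  have hart : IsArtinian R Q := (isFiniteLength_iff_isNoetherian_isArtinian.1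
    (Module.length_ne_top_iff.1 hfin.ne)).2
  -- the chain of the `𝔪ᵃ Q` stabilizes, and at zero by Nakayama's lemma
  obtain ⟨a, ha⟩ : ∃ a : ℕ, m ^ a • (⊤ : Submodule R Q) = ⊥ := by
    obtain ⟨a, ha⟩ := IsArtinian.monotone_stabilizes (R := R) (M := Q)
      ⟨fun i => OrderDual.toDual (m ^ i • (⊤ : Submodule R Q)),
        fun i j hij => Submodule.smul_mono_left (Ideal.pow_le_pow_right hij)⟩
    refine ⟨a, Submodule.eq_bot_of_le_smul_of_le_jacobson_bot m _ (IsNoetherian.noetherian _) ?_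
      (IsLocalRing.maximalIdeal_le_jacobson _)⟩
    rw [← Submodule.mul_smul, ← pow_succ']
    exact le_of_eq (congrArg OrderDual.ofDual (ha (a + 1) a.le_succ))
  have hmr : m ^ a * I ^ r ≤ J ^ r := by
    refine Ideal.mul_le.2 fun x hx y hy => ?_
    have h1 : x • (Submodule.Quotient.mk ⟨y, hy⟩ : Q) ∈ m ^ a • (⊤ : Submodule R Q) :=
      Submodule.smul_mem_smul hx Submodule.mem_top
    rw [ha, Submodule.mem_bot, ← Submodule.Quotient.mk_smul] at h1
    exact ((Submodule.Quotient.mk_eq_zero _).1 h1 :)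
  obtain ⟨n₀, hn₀⟩ := h.exists_pow_add_eq
  -- with `N = r n₀`: `𝔪^(a n₀) Iᴺ = (𝔪ᵃ Iʳ)^n₀ ⊆ Jᴺ`, and `Iᴺ⁺ʲ = Jʲ Iᴺ`
  have hN : ∀ j, I ^ (r * n₀ + j) = J ^ j * I ^ (r * n₀) := hn₀ _ (Nat.le_mul_of_pos_left _ hr)
  refine ⟨a * n₀, r * n₀, hN, fun j => ?_⟩
  rw [hN, mul_left_comm, add_comm, pow_add]
  refine Ideal.mul_mono_right ?_
  rw [pow_mul, pow_mul, pow_mul, ← mul_pow]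
  exact Ideal.pow_right_mono hmr n₀

end LengthBounds

/-! ### The Hilbert function of the fiber cone -/

section FiberCone

open IsLocalRing

variable {R : Type*} [CommRing R] {K J : Ideal R}

/-- The data of an algebra `F` over `R` with a multiplicative family of maps `Jⁿ → F` whose images
span it, such that the kernel of the map `⨁ₙ Jⁿ → F` is contained in `⨁ₙ K Jⁿ`. -/
structure IsFormFamily {F : Type*} [CommRing F] [Algebra R F] (K J : Ideal R)
    (φ : ∀ n, ↥(J ^ n) →ₗ[R] F) : Prop where
  zero_apply : ∀ a, φ 0 a = algebraMap R F a
  apply_mul : ∀ n (a : ↥(J ^ n)) (b : ↥(J ^ 1)) (c : ↥(J ^ (n + 1))), (c : R) = a * b →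
    φ n a * φ 1 b = φ (n + 1) c
  mem_of_sum_eq_zero : ∀ n (a : Π j : Fin n, ↥(J ^ (j : ℕ))), ∑ j : Fin n, φ j (a j) = 0 →
    ∀ j : Fin n, (a j : R) ∈ K * J ^ (j : ℕ)
  mem_of_forall : ∀ S : Submodule R F, (∀ n a, φ n a ∈ S) → S = ⊤

theorem isFormFamily_form (K J : Ideal R) :
    IsFormFamily (F := reesAlgebra J ⧸ reesIdeal K J) K J (form K J) where
  zero_apply _ := rfl
  apply_mul n a b c hc := form_mul_eq rfl a b c hc
  mem_of_sum_eq_zero n a h j := by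
    simp only [form_apply] at h
    rw [← map_sum, Ideal.Quotient.eq_zero_iff_mem, mem_reesIdeal] at h
    have hj := h j
    rw [AddSubmonoidClass.coe_finsetSum, finsetSum_coeff, Finset.sum_eq_single j] at hj
    · simpa [reesMonomial] using hj
    · intro i _ hij
      change (monomial (i : ℕ) (a i : R)).coeff j = 0
      rw [coeff_monomial, if_neg fun h => hij (Fin.ext h)]
    · simp
  mem_of_forall S hS := by
    rw [eq_top_iff]
    intro y _
    obtain ⟨g, rfl⟩ := Ideal.Quotient.mk_surjective y
    rw [eq_sum_reesMonomial g, map_sum]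
    exact Submodule.sum_mem _ fun n _ => hS n _

section FormFamily

variable {F : Type*} [CommRing F] [Algebra R F] {φ : ∀ n, ↥(J ^ n) →ₗ[R] F}

/-- The part of degree at most `1` of the algebra of a family of forms. -/
noncomputable def degreeLEOne (φ : ∀ n, ↥(J ^ n) →ₗ[R] F) : Submodule R F :=
  1 ⊔ LinearMap.range (φ 1)

theorem IsFormFamily.mem_degreeLEOne_pow (h : IsFormFamily K J φ) {n : ℕ} (a : ↥(J ^ n)) :
    φ n a ∈ degreeLEOne φ ^ n := by
  suffices ∀ r ∈ J ^ n, ∃ h : r ∈ J ^ n, φ n ⟨r, h⟩ ∈ degreeLEOne φ ^ n from (this a a.2).2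
  clear a
  induction n with
  | zero =>
    intro r hr
    refine ⟨hr, ?_⟩
    rw [pow_zero, Submodule.mem_one]
    exact ⟨r, (h.zero_apply ⟨r, hr⟩).symm⟩
  | succ n ih =>
    intro r hr
    rw [pow_succ] at hr
    refine Submodule.mul_induction_on hr (fun b hb c hc => ?_) (fun b c hb hc => ?_)
    · have hc1 : c ∈ J ^ 1 := by rwa [pow_one]
      refine ⟨by rw [pow_succ]; exact Ideal.mul_mem_mul hb hc, ?_⟩
      rw [← h.apply_mul n ⟨b, hb⟩ ⟨c, hc1⟩ _ rfl, pow_succ]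
      exact Submodule.mul_mem_mul (ih b hb).2 (Submodule.mem_sup_right ⟨_, rfl⟩)
    · obtain ⟨hb, hb'⟩ := hb
      obtain ⟨hc, hc'⟩ := hc
      have := add_mem hb' hc'
      rw [← map_add] at this
      exact ⟨add_mem hb hc, this⟩

theorem degreeLEOne_pow_mono (φ : ∀ n, ↥(J ^ n) →ₗ[R] F) : Monotone fun n => degreeLEOne φ ^ n :=
  fun _ _ h => pow_le_pow_right₀ (le_sup_left : (1 : Submodule R F) ≤ _) h

theorem IsFormFamily.sum_relLength_le (h : IsFormFamily K J φ) (n : ℕ) :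
    ∑ j ∈ Finset.range n, relLength (J ^ j) (K * J ^ j) ≤
      Module.length R ↥(degreeLEOne φ ^ n) := by
  let ψ : (Π j : Fin n, ↥(J ^ (j : ℕ))) →ₗ[R] ↥(degreeLEOne φ ^ n) :=
    LinearMap.codRestrict _ (∑ j : Fin n, φ j ∘ₗ LinearMap.proj j) fun a => by
      rw [LinearMap.sum_apply]
      exact Submodule.sum_mem _ fun j _ =>
        degreeLEOne_pow_mono φ j.2.le (h.mem_degreeLEOne_pow (a j))
  have hker : LinearMap.ker ψ ≤ Submodule.pi Set.univ
      fun j : Fin n => (K * J ^ (j : ℕ)).submoduleOf (J ^ (j : ℕ)) := by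
    intro a ha j _
    refine h.mem_of_sum_eq_zero n a ?_ j
    have := congrArg Subtype.val (LinearMap.mem_ker.1 ha)
    simpa [ψ, LinearMap.sum_apply] using this
  have h1 := Module.length_le_of_surjective (Submodule.factor hker) (Submodule.factor_surjective _)
  have h2 := Module.length_le_of_injective (Submodule.liftQ _ ψ le_rfl)
    (LinearMap.ker_eq_bot.1 (Submodule.ker_liftQ_eq_bot _ ψ le_rfl le_rfl))
  have h3 := (h1.trans h2)
  rw [(Submodule.quotientPi _).length_eq, Module.length_pi_of_fintype] at h3
  rw [Finset.sum_range]
  exact h3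

theorem degreeLEOne_fg [IsNoetherianRing R] (φ : ∀ n, ↥(J ^ n) →ₗ[R] F) :
    (degreeLEOne φ).FG := by
  refine Submodule.FG.sup ?_ ?_
  · rw [Submodule.one_eq_span]
    exact Submodule.fg_span_singleton _
  · rw [LinearMap.range_eq_map]
    exact (IsNoetherian.noetherian _).map _

theorem IsFormFamily.adjoin_eq_top (h : IsFormFamily K J φ) {d : ℕ} (f : Fin d → ↥(J ^ 1))
    (hf : Submodule.span R (Set.range f) = ⊤) :
    Algebra.adjoin R (Set.range fun i => φ 1 (f i)) = ⊤ := by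
  set S := Algebra.adjoin R (Set.range fun i => φ 1 (f i))
  have h1 : degreeLEOne φ ≤ Subalgebra.toSubmodule S := by
    refine sup_le ?_ ?_
    · rw [Submodule.one_le]
      exact one_mem S
    · rw [LinearMap.range_eq_map, ← hf, Submodule.map_span, Submodule.span_le]
      rintro _ ⟨_, ⟨i, rfl⟩, rfl⟩
      exact Algebra.subset_adjoin ⟨i, rfl⟩
  have hpow : ∀ n, degreeLEOne φ ^ n ≤ Subalgebra.toSubmodule S := by
    intro n
    induction n with
    | zero =>
      rw [pow_zero, Submodule.one_le]
      exact one_mem S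
    | succ n ih =>
      rw [pow_succ, Submodule.mul_le]
      exact fun x hx y hy => S.mul_mem (ih hx) (h1 hy)
  have htop := h.mem_of_forall (Subalgebra.toSubmodule S)
    fun n a => hpow n (h.mem_degreeLEOne_pow a)
  rwa [Algebra.toSubmodule_eq_top] at htop

end FormFamily

variable [IsLocalRing R]

theorem algebraMap_fiberCone_eq_zero (J : Ideal R) (r : R) (hr : r ∈ maximalIdeal R) :
    algebraMap R (FiberCone J) r = 0 := by
  refine Ideal.Quotient.eq_zero_iff_mem.2 fun n => ?_
  change (C r).coeff n ∈ _
  rw [coeff_C]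
  split_ifs with hn
  · subst hn
    simpa using hr
  · exact zero_mem _

theorem nontrivial_fiberCone (J : Ideal R) : Nontrivial (FiberCone J) := by
  refine Ideal.Quotient.nontrivial_iff.2 fun h => ?_
  have h1 : (1 : reesAlgebra J) ∈ reesIdeal (maximalIdeal R) J := h ▸ Submodule.mem_top
  have h2 := mem_reesIdeal.1 h1 0
  rw [pow_zero, mul_one, OneMemClass.coe_one, coeff_one_zero] at h2
  exact (Ideal.ne_top_iff_one _).1 (maximalIdeal.isMaximal R).ne_top h2

/-- The Hilbert function of the fiber cone of `J` sums to a function of order at most `n ^ s` for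
some `s ≤ l(J)`. -/
theorem exists_sum_relLength_le [IsNoetherianRing R] (J : Ideal R) :
    ∃ s c : ℕ, ((s : ℕ∞) : WithBot ℕ∞) ≤ analyticSpread J ∧ ∀ n : ℕ,
      ∑ j ∈ Finset.range n, relLength (J ^ j) (maximalIdeal R * J ^ j) ≤ (c * (n + 1) ^ s : ℕ) := by
  have := nontrivial_fiberCone J
  obtain ⟨s, hs, h⟩ := exists_length_pow_le R (FiberCone J) (algebraMap_fiberCone_eq_zero J)
  obtain ⟨c, hc⟩ := h (degreeLEOne (form (maximalIdeal R) J)) (degreeLEOne_fg _)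
  exact ⟨s, c, hs, fun n => ((isFormFamily_form _ J).sum_relLength_le n).trans (hc n)⟩

/-- The analytic spread of `J` is at most the number of generators of `J`. -/
theorem analyticSpread_le {J : Ideal R} {d : ℕ} (f : Fin d → R)
    (hf : Ideal.span (Set.range f) = J) : analyticSpread J ≤ ((d : ℕ∞) : WithBot ℕ∞) := by
  have hmem : ∀ i, f i ∈ J ^ 1 := fun i => by
    rw [pow_one, ← hf]
    exact Ideal.subset_span ⟨i, rfl⟩
  refine ringKrullDim_le_of_adjoin_eq_top R (FiberCone J)
    (fun i => form (maximalIdeal R) J 1 ⟨f i, hmem i⟩)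
    ((isFormFamily_form _ J).adjoin_eq_top (fun i => ⟨f i, hmem i⟩) ?_)
    (algebraMap_fiberCone_eq_zero J)
  apply Submodule.map_injective_of_injective (J ^ 1).injective_subtype
  rw [Submodule.map_span, ← Set.range_comp, Submodule.map_top, Submodule.range_subtype]
  exact hf.trans (pow_one J).symm

theorem exists_analyticSpread_eq [IsNoetherianRing R] (J : Ideal R) :
    ∃ l : ℕ, analyticSpread J = ((l : ℕ∞) : WithBot ℕ∞) := by
  have := nontrivial_fiberCone J
  obtain ⟨d, f, hf⟩ := Submodule.fg_iff_exists_fin_generating_family.1 (IsNoetherian.noetherian J)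
  have hle := analyticSpread_le f hf
  have hbot : analyticSpread J ≠ ⊥ := by
    have h0 : 0 ≤ analyticSpread J := ringKrullDim_nonneg_of_nontrivial
    rintro h
    rw [h] at h0
    exact absurd (le_bot_iff.1 h0) (by simp)
  obtain ⟨a, ha⟩ := WithBot.ne_bot_iff_exists.1 hbot
  rw [← ha] at hle ⊢
  obtain ⟨l, rfl⟩ := ENat.ne_top_iff_exists.1
    ((WithBot.coe_le_coe.1 hle).trans_lt (ENat.natCast_lt_top d)).ne
  exact ⟨l, rfl⟩

end FiberCone

/-! ### Bounds for the degree -/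

section Degree

variable {R : Type*} [CommRing R] {I J : Ideal R} {P : ℚ[X]}

/-- A lower bound on `λ(Iⁿ / Jⁿ)` along an arithmetic progression bounds the degree of `P(I/J)`. -/
theorem IsReesPolynomial.le_polyDegree (hP : IsReesPolynomial I J P) {g D : ℕ} (hD : 1 ≤ D)
    (h : ∀ k : ℕ, (g.multichoose k : ℕ∞) ≤ powQuotLength I J (1 + D * k)) :
    (g : ℤ) - 1 ≤ polyDegree P := by
  have htend : Tendsto (fun k : ℕ => 1 + D * k) atTop atTop :=
    tendsto_atTop_mono (fun k => (Nat.le_mul_of_pos_left k hD).trans (Nat.le_add_left _ _))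
      tendsto_id
  refine le_polyDegree_of_multichoose_le P g D ((htend.eventually hP).mono ?_)
  rintro k ⟨n, hn, hPn⟩
  have := h k
  rw [hn, Nat.cast_le] at this
  rw [hPn]
  exact_mod_cast this

/-- All regular sequences in `G(J)₊` have length at most `deg P(I/J) + 1`; in particular the grade,
a supremum in `ℕ∞`, is finite. -/
theorem grade_sub_one_le_polyDegree [IsNoetherianRing R] (hJI : J < I)
    (hP : IsReesPolynomial I J P) :
    ∃ g : ℕ, grade (A := AssocGraded J) (assocGradedPlus J) = (g : ℕ∞) ∧
      (g : ℤ) - 1 ≤ polyDegree P := by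
  have hdeg := neg_one_le_polyDegree P
  have hle : grade (A := AssocGraded J) (assocGradedPlus J) ≤
      ((polyDegree P + 1).toNat : ℕ∞) := by
    refine sSup_le ?_
    rintro _ ⟨rs, hrs, hreg, rfl⟩
    obtain ⟨D, hD, h⟩ :=
      exists_multichoose_le_of_isWeaklyRegular hJI rs.length rs rfl hrs hreg.toIsWeaklyRegular
    have := hP.le_polyDegree hD h
    rw [Nat.cast_le]
    omega
  obtain ⟨g, hg⟩ := ENat.ne_top_iff_exists.1 (hle.trans_lt (ENat.natCast_lt_top _)).ne
  rw [← hg, Nat.cast_le] at hle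
  exact ⟨g, hg.symm, by omega⟩

/-- A bound of the sums of the Hilbert function of the fiber cone of `J` by a multiple of `n ^ s`
bounds the degree of `P(I/J)` by `s - 1`. -/
theorem IsReesPolynomial.polyDegree_le (hP : IsReesPolynomial I J P) {N c₀ c s : ℕ}
    {H : ℕ → ℕ∞} (hle : ∀ j, powQuotLength I J (N + j) ≤ c₀ * H j)
    (hH : ∀ n : ℕ, ∑ j ∈ Finset.range n, H j ≤ (c * (n + 1) ^ s : ℕ)) :
    polyDegree P ≤ (s : ℤ) - 1 := by
  obtain ⟨M, hM⟩ := eventually_atTop.1 hP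
  have hfin : ∀ j, ∃ k : ℕ, (k : ℕ∞) = H j := fun j => by
    refine ENat.ne_top_iff_exists.1 (ne_of_lt ?_)
    refine ((Finset.single_le_sum (fun _ _ => zero_le) (Finset.self_mem_range_succ j)).trans
      (hH (j + 1))).trans_lt (ENat.natCast_lt_top _)
  choose h hh using hfin
  have hsum : ∀ n : ℕ, ∑ j ∈ Finset.range n, (h j : ℚ) ≤ c * ((n : ℚ) + 1) ^ s := fun n => by
    have := hH n
    simp only [← hh] at this
    exact_mod_cast this
  have hval : ∀ j, N + j ≥ M → |P.eval ((N + j : ℕ) : ℚ)| ≤ c₀ * h j := fun j hj => by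
    obtain ⟨k, hk, hPk⟩ := hM _ hj
    have := hle j
    rw [hk, ← hh] at this
    rw [hPk, abs_of_nonneg (Nat.cast_nonneg k)]
    exact_mod_cast this
  -- the first `N + M` values, for which `P` need not agree with the length, add up to a constant
  set A : ℚ := ∑ j ∈ Finset.range (N + M), |P.eval (j : ℚ)| with hA
  have hA0 : 0 ≤ A := Finset.sum_nonneg fun _ _ => abs_nonneg _
  refine polyDegree_le_of_sum_le P s (A + c₀ * c)
    ((eventually_ge_atTop (N + M)).mono fun n hn => ?_)
  obtain ⟨t, rfl⟩ := Nat.exists_eq_add_of_le hn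
  refine (Finset.abs_sum_le_sum_abs _ _).trans ?_
  rw [Finset.sum_range_add, ← hA]
  have h1 : ∑ j ∈ Finset.range t, |P.eval ((N + M + j : ℕ) : ℚ)| ≤
      c₀ * (c * (((N + M + t : ℕ) : ℚ) + 1) ^ s) := by
    calc ∑ j ∈ Finset.range t, |P.eval ((N + M + j : ℕ) : ℚ)|
        ≤ ∑ j ∈ Finset.range t, (c₀ * h (M + j) : ℚ) := Finset.sum_le_sum fun j _ => by
          rw [add_assoc]
          exact hval _ (by omega)
      _ = c₀ * ∑ j ∈ Finset.range t, (h (M + j) : ℚ) := by rw [Finset.mul_sum]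
      _ ≤ c₀ * ∑ j ∈ Finset.range (M + t), (h j : ℚ) := by
          rw [Finset.sum_range_add]
          gcongr
          exact le_add_of_nonneg_left (Finset.sum_nonneg fun _ _ => Nat.cast_nonneg _)
      _ ≤ c₀ * ∑ j ∈ Finset.range (N + M + t), (h j : ℚ) := by
          gcongr
          omega
      _ ≤ _ := by
          gcongr
          exact hsum _
  have h2 : A ≤ A * (((N + M + t : ℕ) : ℚ) + 1) ^ s :=
    le_mul_of_one_le_right hA0 (one_le_pow₀ (le_add_of_nonneg_left (Nat.cast_nonneg _)))
  calc _ ≤ A * (((N + M + t : ℕ) : ℚ) + 1) ^ s + c₀ * (c * (((N + M + t : ℕ) : ℚ) + 1) ^ s) :=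
        add_le_add h2 h1
    _ = _ := by ring

end Degree

end ReesDegree

theorem theorem3p5 {R : Type*} [CommRing R] [IsNoetherianRing R] [IsLocalRing R]
    (I J : Ideal R) (hJI : J < I) (hred : ReesDegree.IsReduction J I)
    (hfin : ∃ r : ℕ, 0 < r ∧ ReesDegree.powQuotLength I J r < ⊤) :
    ∃ (P : Polynomial ℚ) (g l : ℕ),
      ReesDegree.IsReesPolynomial I J P ∧
      ReesDegree.grade (A := ReesDegree.AssocGraded J) (ReesDegree.assocGradedPlus J) = (g : ℕ∞) ∧
      ReesDegree.analyticSpread J = ((l : ℕ∞) : WithBot ℕ∞) ∧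
      (g : ℤ) - 1 ≤ ReesDegree.polyDegree P ∧
      ReesDegree.polyDegree P ≤ (l : ℤ) - 1 ∧
      (ReesDegree.IsCompleteIntersectionIdeal J →
        ReesDegree.polyDegree P = (l : ℤ) - 1) := by
  open ReesDegree in
  obtain ⟨r, hr, hfin⟩ := hfin
  obtain ⟨K, N, hN, hK⟩ := hred.exists_pow_mul_le hr hfin
  obtain ⟨c₀, hc₀⟩ := exists_powQuotLength_add_le _ hN hK
  obtain ⟨s, c, hs, hc⟩ := exists_sum_relLength_le J
  obtain ⟨l, hl⟩ := exists_analyticSpread_eq J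
  have hfin' : ∀ᶠ n in atTop, powQuotLength I J n < ⊤ := by
    refine (eventually_ge_atTop N).mono fun n hn => ?_
    obtain ⟨j, rfl⟩ := Nat.exists_eq_add_of_le hn
    refine (hc₀ j).trans_lt (WithTop.mul_lt_top (ENat.natCast_lt_top _) ?_)
    exact ((Finset.single_le_sum (fun _ _ => zero_le) (Finset.self_mem_range_succ j)).trans
      (hc (j + 1))).trans_lt (ENat.natCast_lt_top _)
  obtain ⟨P, hP⟩ := hred.exists_isReesPolynomial hfin'
  obtain ⟨g, hg, hgP⟩ := grade_sub_one_le_polyDegree hJI hP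
  have hsl : s ≤ l := by
    rw [hl] at hs
    exact_mod_cast hs
  have hPl : polyDegree P ≤ (l : ℤ) - 1 := by
    have := hP.polyDegree_le hc₀ hc
    omega
  refine ⟨P, g, l, hP, hg, hl, hgP, hPl, ?_⟩
  rintro ⟨rs, hrs, rfl⟩
  have hmem : ∀ x ∈ rs, x ∈ IsLocalRing.maximalIdeal R := fun x hx =>
    IsLocalRing.le_maximalIdeal (hJI.trans_le le_top).ne (Ideal.subset_span hx)
  obtain ⟨D, hD, h⟩ := exists_multichoose_le_of_ofList rs hmem hrs.toIsWeaklyRegular hJI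
  have hlow := hP.le_polyDegree hD h
  have hspread : l ≤ rs.length := by
    have := analyticSpread_le (J := Ideal.ofList rs) rs.get
      (by rw [Set.range_list_get])
    rw [hl] at this
    exact_mod_cast this
  omega
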